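/- Let $X\subset\mathbb{R}^d$ and $Y\subset\mathbb{R}$ be compact, and let $E$ be a probability measure on the space $\mathcal{M}_1^+(X\times Y)$ of Borel probability measures on $X\times Y$ (with the topology of weak convergence), with support $\mathrm{Supp}(E)$. For $P\in\mathcal{M}_1^+(X\times Y)$ let $P_X$ be its marginal on $X$, write $L^2(P):=L^2(X,P_X)$, and let $f_P(x)=\int_Y y\,dP(y|x)$ be its regression function; $L^2(X)$ refers to Lebesgue measure on $X$. Let $M:=\sup_{y\in Y}|y|$. Let $\mathcal{K}$ be a family of continuous positive semidefinite kernels $k:X\times X\to\mathbb{R}$ and let $\kappa>0$ satisfy $|k(x,x)|\le\kappa^2$ for all $k\in\mathcal{K}$, $x\in X$. For $k\in\mathcal{K}$ let $\mathcal{H}_k$ be its reproducing kernel Hilbert space, let $G_{k,P}f=\int_X f(x)\,k(\cdot,x)\,dP_X(x)$ on $L^2(P)$, and for a positive operator $T$ let $\gamma_T(\lambda)=\mathrm{Tr}\big((T+\lambda I)^{-1}T\big)$. Let $c_1,c_2,c^*>0$ and $0<c_3\le1$ be constants such that: (A2) for every $P\in\mathrm{Supp}(E)$ there are a kernel $k_P\in\mathcal{K}$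 and $g_P\in L^2(P)$ with $f_P=G_{k_P,P}^{1/2}g_P$ in $L^2(P)$ and $\|g_P\|_{L^2(P)}\le c_1$ (fix such kernels $k_P$); (A3) $\gamma_{G_{k,P}}(\lambda)\le c_2\lambda^{-c_3}$ for all $P\in\mathrm{Supp}(E)$, $\lambda>0$ and $k\in\mathcal{K}$; (B1) $\|f\|_{L^2(X)}\le c^*\|f\|_{L^2(P)}$ for all $P\in\mathrm{Supp}(E)$ and all $f\in L^2(P)$. For $\mathbf{z}=(x_j,y_j)_{j=1}^n\in(X\times Y)^n$ and $\lambda>0$ let $$f_{\mathbf{z}}^{\lambda}=\operatorname*{argmin}_{f\in\mathcal{H}_{k_P}}\ \frac1n\sum_{j=1}^n\big(f(x_j)-y_j\big)^2+\lambda\|f\|_{\mathcal{H}_{k_P}}^2 .$$ Put $$c_8:=\big(6\,\Gamma(9)+\log(6^8)\big)\Big(\frac{8M}{\kappa}+6c_1\Big)^2\Big[4\big(\kappa^2+\kappa\sqrt{c_2}\big)^2+1\Big]^2\big(2\kappa^2+2\kappa\sqrt{c_2}+1\big)^4 .$$ Then $c_8>0$, and for every $P\in\mathrm{Supp}(E)$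 and every integer $n\ge1$, with $\lambda=n^{-1/(c_3+1)}$, $$\int_{(X\times Y)^n}\big\|f_{\mathbf{z}}^{\lambda}-f_P\big\|_{L^2(X)}^2\,dP^n(\mathbf{z})\ \le\ (c^*)^2\,c_8\,n^{-\frac{1}{c_3+1}} .$$ In particular $c_8$ does not depend on $P$. -/

import Mathlib

open MeasureTheory ProbabilityTheory TopologicalSpace
open scoped ENNReal

noncomputable section

namespace KernelRidge

/-! ### Kernels and their reproducing kernel Hilbert spaces -/

/-- A continuous (symmetric) positive semidefinite kernel `k : X × X → ℝ`.  `Matrix.PosSemidef`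
contains the symmetry of `k`, and says that `∑ᵢⱼ cᵢ cⱼ k(xᵢ, xⱼ) ≥ 0` for all finite families. -/
structure ContKernel (X : Type*) [TopologicalSpace X] where
  /-- the kernel function -/
  toMap : C(X × X, ℝ)
  posSemidef : (Matrix.of fun x y : X => toMap (x, y)).PosSemidef

section RKHSpace

variable {X : Type*} [TopologicalSpace X]

/-- The kernel as an infinite matrix of operators `ℝ → ℝ` (multiplication by `k(x, y)`), the form
in which Mathlib's construction of the reproducing kernel Hilbert space takes it. -/
def ContKernel.opMatrix (k : ContKernel X) : Matrix X X (ℝ →L[ℝ] ℝ) :=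
  Matrix.of fun x y => k.toMap (x, y) • ContinuousLinearMap.id ℝ ℝ

theorem ContKernel.opMatrix_posSemidef (k : ContKernel X) : k.opMatrix.PosSemidef := by
  refine ((RKHS.posSemidef_tfae (𝕜 := ℝ) (V := ℝ) (K := k.opMatrix)).out 0 2).mpr ?_
  refine ⟨?_, fun v => ?_⟩
  · ext x y
    have h := k.posSemidef.isHermitian.apply x y
    simp only [Matrix.of_apply, star_trivial] at h
    simp [Matrix.conjTranspose_apply, ContKernel.opMatrix, h,
      ContinuousLinearMap.star_eq_adjoint, ContinuousLinearMap.adjoint_id]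
  · have h := k.posSemidef.2 v
    simp only [Matrix.of_apply, star_trivial] at h
    rw [Finsupp.sum_comm] at h
    refine h.trans (le_of_eq ?_)
    simp only [RCLike.re_to_real]
    refine Finsupp.sum_congr fun x _ => Finsupp.sum_congr fun y _ => ?_
    simp only [ContKernel.opMatrix, Matrix.of_apply, smul_apply,
      ContinuousLinearMap.id_apply, smul_eq_mul, RCLike.inner_apply, conj_trivial]
    ring

instance (k : ContKernel X) : Fact k.opMatrix.PosSemidef := ⟨k.opMatrix_posSemidef⟩

/-- The reproducing kernel Hilbert space `H_k`; its elements are functions `X → ℝ`. -/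
abbrev ContKernel.Space (k : ContKernel X) : Type _ := RKHS.OfKernel k.opMatrix

/-- The regularized empirical risk `(1/n) ∑ⱼ (f(xⱼ) - yⱼ)² + lam ‖f‖²` on `H_k`. -/
def ridgeObjective (k : ContKernel X) (lam : ℝ) {n : ℕ} (z : Fin n → X × ℝ) (f : k.Space) : ℝ :=
  (1 / (n : ℝ)) * ∑ j, (f (z j).1 - (z j).2) ^ 2 + lam * ‖f‖ ^ 2

/-- The kernel ridge estimator: the minimizer over `H_k` of the regularized empirical risk
(which exists and is unique for `lam > 0`). -/
def ridgeEstimator (k : ContKernel X) (lam : ℝ) {n : ℕ} (z : Fin n → X × ℝ) : k.Space :=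
  Classical.epsilon fun f => IsMinOn (ridgeObjective k lam z) Set.univ f

end RKHSpace

/-! ### The integral operator, its square root and its effective dimension -/

section IntegralOperator

variable {X : Type*} [TopologicalSpace X] [CompactSpace X] [MeasurableSpace X] [BorelSpace X]
  [SecondCountableTopologyEither X ℝ]

/-- The kernel section `k(x, ·)` as an element of `L²(μ)`. -/
def ContKernel.sectionLp (k : ContKernel X) (μ : Measure X) [IsFiniteMeasure μ] (x : X) :
    Lp ℝ 2 μ :=
  ContinuousMap.toLp 2 μ ℝ (k.toMap.curry x)

/-- The continuous function `x ↦ ⟨k(x, ·), f⟩_{L²(μ)} = ∫ k(x, x') f(x') dμ(x')`. -/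
def ContKernel.integralFun (k : ContKernel X) (μ : Measure X) [IsFiniteMeasure μ] (f : Lp ℝ 2 μ) :
    C(X, ℝ) where
  toFun x := inner ℝ (k.sectionLp μ x) f
  continuous_toFun := by
    have h : Continuous fun x => k.sectionLp μ x :=
      (ContinuousMap.toLp 2 μ ℝ).continuous.comp k.toMap.curry.continuous
    exact h.inner continuous_const

/-- The integral formula for `ContKernel.integralFun`. -/
theorem ContKernel.integralFun_apply (k : ContKernel X) (μ : Measure X) [IsFiniteMeasure μ]
    (f : Lp ℝ 2 μ) (x : X) : k.integralFun μ f x = ∫ x', k.toMap (x, x') * f x' ∂μ := by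
  change inner ℝ (k.sectionLp μ x) f = _
  rw [L2.inner_def]
  refine integral_congr_ae ?_
  filter_upwards [ContinuousMap.coeFn_toLp (p := 2) (𝕜 := ℝ) μ (k.toMap.curry x)] with x' hx'
  simp only [ContKernel.sectionLp, hx', RCLike.inner_apply, conj_trivial]
  exact mul_comm _ _

/-- `f ↦ ∫ k(·, x') f(x') dμ(x')` as a bounded linear map from `L²(μ)` to `C(X)`. -/
def ContKernel.integralCLM (k : ContKernel X) (μ : Measure X) [IsFiniteMeasure μ] :
    Lp ℝ 2 μ →L[ℝ] C(X, ℝ) :=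
  LinearMap.mkContinuous
    { toFun := k.integralFun μ
      map_add' := fun f g => ContinuousMap.ext fun x => inner_add_right (𝕜 := ℝ) (k.sectionLp μ x) f g
      map_smul' := fun c f => ContinuousMap.ext fun x =>
        real_inner_smul_right (k.sectionLp μ x) f c }
    (‖(ContinuousMap.toLp 2 μ ℝ : C(X, ℝ) →L[ℝ] Lp ℝ 2 μ)‖ * ‖k.toMap.curry‖)
    (fun f => by
      refine (ContinuousMap.norm_le _ (by positivity)).2 fun x => ?_
      refine (norm_inner_le_norm (𝕜 := ℝ) (k.sectionLp μ x) f).trans ?_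
      refine mul_le_mul_of_nonneg_right ?_ (norm_nonneg _)
      refine (ContinuousLinearMap.le_opNorm _ _).trans ?_
      exact mul_le_mul_of_nonneg_left (k.toMap.curry.norm_coe_le_norm x) (norm_nonneg _))

/-- The integral operator `G_{k,μ} f = ∫ f(x) k(·, x) dμ(x)` on `L²(μ)`. -/
def ContKernel.integralOp (k : ContKernel X) (μ : Measure X) [IsFiniteMeasure μ] :
    Lp ℝ 2 μ →L[ℝ] Lp ℝ 2 μ :=
  (ContinuousMap.toLp 2 μ ℝ).comp (k.integralCLM μ)

end IntegralOperator

section Operators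

variable {H : Type*} [NormedAddCommGroup H] [InnerProductSpace ℝ H] [CompleteSpace H]

/-- `S` is the positive square root `T^{1/2}` of the positive operator `T`. -/
def IsPositiveSqrt (S T : H →L[ℝ] H) : Prop := S.IsPositive ∧ S ∘L S = T

/-- The trace `∑ᵢ ⟨A eᵢ, eᵢ⟩ ∈ [0, ∞]` of a positive operator `A` over an orthonormal basis
(the value does not depend on the basis). -/
def positiveTrace (A : H →L[ℝ] H) : ℝ≥0∞ :=
  ∑' i, ENNReal.ofReal
    (inner ℝ (A ((exists_hilbertBasis ℝ H).choose_spec.choose i))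
      ((exists_hilbertBasis ℝ H).choose_spec.choose i))

/-- The effective dimension `γ_T(lam) = Tr ((T + lam I)⁻¹ T)` of a positive operator `T`. -/
def effectiveDimension (T : H →L[ℝ] H) (lam : ℝ) : ℝ≥0∞ :=
  positiveTrace (Ring.inverse (T + lam • ContinuousLinearMap.id ℝ H) ∘L T)

end Operators

/-! ### The regression function and the regularity condition -/

section Regression

variable {X : Type*} [TopologicalSpace X] [CompactSpace X] [MeasurableSpace X] [BorelSpace X]
  [SecondCountableTopologyEither X ℝ] {Y : Set ℝ}

/-- The regression function `f_P(x) = ∫ y dP(y | x)`. -/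
def regressionFunction (P : Measure (X × Y)) [IsFiniteMeasure P] (x : X) : ℝ :=
  ∫ y, y ∂(condDistrib (fun z : X × Y => (z.2 : ℝ)) Prod.fst P x)

/-- `f_P = G_{k,P}^{1/2} g_P` in `L²(P)` for some `g_P` with `‖g_P‖_{L²(P)} ≤ c₁`. -/
def SourceCondition (k : ContKernel X) (P : Measure (X × Y)) [IsFiniteMeasure P] (c₁ : ℝ) : Prop :=
  ∃ S : Lp ℝ 2 P.fst →L[ℝ] Lp ℝ 2 P.fst, IsPositiveSqrt S (k.integralOp P.fst) ∧
    ∃ g : Lp ℝ 2 P.fst, ‖g‖ ≤ c₁ ∧ regressionFunction P =ᵐ[P.fst] S g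

end Regression

/-- Lebesgue measure on a subset `X` of `ℝᵈ`, as a measure on the subtype. -/
def lebesgueOn {d : ℕ} (X : Set (EuclideanSpace ℝ (Fin d))) : Measure X :=
  (volume : Measure (EuclideanSpace ℝ (Fin d))).comap Subtype.val

/-- The constant `c₈`, where `M = sup_{y ∈ Y} |y|`. -/
def ridgeConstant (κ M c₁ c₂ : ℝ) : ℝ :=
  (6 * Real.Gamma 9 + Real.log (6 ^ 8)) * (8 * M / κ + 6 * c₁) ^ 2 *
    (4 * (κ ^ 2 + κ * √c₂) ^ 2 + 1) ^ 2 * (2 * κ ^ 2 + 2 * κ * √c₂ + 1) ^ 4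

end KernelRidge

end

/-! The bound is proved in expectation, without operator concentration inequalities. Write `φ` for
the feature map into the kernel space, `Σ` for its covariance under `P_X`, `L = nλ`, and `R = (L + ∑
φ(x_j) ⊗ φ(x_j))⁻¹`. Since `G = I I*`, where `I` is the inclusion of the kernel space into `L²(P)`,
a function in the range of `G^{1/2}` has a representative `h` in the kernel space with `‖h‖ ≤ c₁`
(`exists_preimage_of_sqrt`). With residuals `ε_j = y_j - h(x_j)`, the normal equations give `f_z - h
= R(∑ ε_j φ(x_j)) - L R h`, a noise term and a bias term.

Noise: `R` depends on the inputs only and residuals are orthogonal to functions of the input, so in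
mean square only the diagonal survives, leaving at most `B² E⟨v, R v⟩` at `v = φ(x)`, where `B`
bounds the residuals. `⟨v, R v⟩` is, up to `L`, the minimum of a ridge problem over coefficient
vectors; testing it with `a_j = ⟨φ(x_j), u⟩ / n`, `u = (Σ + λ)⁻¹ v`, replaces `R` by its population
analogue up to the factor `1 + κ²/(nλ)`. Integrating over `x` produces the effective dimension
(`lintegral_eq_effectiveDimension`).

Bias: a fresh test point may be inserted into the sample at the cost of a Sherman-Morrison factor at
most `1 + κ²/L`. By exchangeability its contribution is an average over `n + 1` sample points, and
the sum over sample points is bounded deterministically (`integral_inner_regRes_bias_sq_le`).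

The total is of order `γ(λ)/n + λ`. For `λ = n^{-1/(c₃+1)}` one has `nλ ≥ 1` and `λ^{-c₃}/n = λ`, so
both terms have the stated rate, and `c₈` comfortably exceeds the resulting constant. -/

noncomputable section

namespace KernelRidge

/-! ### Regularized sample covariance operators -/

section Resolvent

variable {H : Type*} [NormedAddCommGroup H] [InnerProductSpace ℝ H]

/-- The operator `u ↦ L u + ∑ᵢ ⟨vᵢ, u⟩ vᵢ`. -/
def regCov {ι : Type*} [Fintype ι] (L : ℝ) (v : ι → H) : H →L[ℝ] H :=
  L • ContinuousLinearMap.id ℝ H + ∑ i, InnerProductSpace.rankOne ℝ (v i) (v i)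

theorem regCov_apply {ι : Type*} [Fintype ι] (L : ℝ) (v : ι → H) (u : H) :
    regCov L v u = L • u + ∑ i, inner ℝ (v i) u • v i := by
  simp [regCov]

theorem inner_regCov {ι : Type*} [Fintype ι] (L : ℝ) (v : ι → H) (u w : H) :
    inner ℝ (regCov L v u) w = L * inner ℝ u w + ∑ i, inner ℝ (v i) u * inner ℝ (v i) w := by
  simp [regCov_apply, inner_add_left, real_inner_smul_left, sum_inner]

theorem inner_regCov_self {ι : Type*} [Fintype ι] (L : ℝ) (v : ι → H) (u : H) :
    inner ℝ (regCov L v u) u = L * ‖u‖ ^ 2 + ∑ i, inner ℝ (v i) u ^ 2 := by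
  simp [inner_regCov, sq]

theorem continuous_regCov {ι : Type*} [Fintype ι] (L : ℝ) :
    Continuous fun v : ι → H => regCov L v := by
  unfold regCov
  refine continuous_const.add (continuous_finsetSum _ fun i _ => ?_)
  exact ((InnerProductSpace.rankOne ℝ).continuous.comp (continuous_apply i)).clm_apply
    (continuous_apply i)

theorem regCov_insertNth {n : ℕ} (L : ℝ) (v : Fin n → H) (i : Fin (n + 1)) (w u : H) :
    regCov L (i.insertNth (α := fun _ => H) w v) u = regCov L v u + inner ℝ w u • w := by
  rw [regCov_apply, regCov_apply, Fin.sum_univ_succAbove _ i]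
  simp only [Fin.insertNth_apply_same, Fin.insertNth_apply_succAbove]
  abel

theorem isUnit_of_coercive [CompleteSpace H] (A : H →L[ℝ] H) {c : ℝ} (hc : 0 < c)
    (h : ∀ u, c * ‖u‖ ^ 2 ≤ inner ℝ (A u) u) : IsUnit A := by
  refine ContinuousLinearMap.isUnit_of_forall_le_norm_inner_map A (c := ⟨c, hc.le⟩) hc fun u => ?_
  rw [mul_comm]
  exact (h u).trans (le_abs_self _)

theorem inverse_apply_self {A : H →L[ℝ] H} (hA : IsUnit A) (u : H) : Ring.inverse A (A u) = u := by
  have := congrArg (fun T : H →L[ℝ] H => T u) (Ring.inverse_mul_cancel A hA)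
  simpa using this

theorem self_apply_inverse {A : H →L[ℝ] H} (hA : IsUnit A) (u : H) : A (Ring.inverse A u) = u := by
  have := congrArg (fun T : H →L[ℝ] H => T u) (Ring.mul_inverse_cancel A hA)
  simpa using this

theorem inner_inverse_comm {A : H →L[ℝ] H} (hA : IsUnit A)
    (hs : ∀ u w, inner ℝ (A u) w = inner ℝ u (A w)) (u w : H) :
    inner ℝ (Ring.inverse A u) w = inner ℝ u (Ring.inverse A w) := by
  conv_lhs => rw [← self_apply_inverse hA w]
  rw [← hs, self_apply_inverse hA]

variable [CompleteSpace H]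

theorem isUnit_regCov {ι : Type*} [Fintype ι] {L : ℝ} (hL : 0 < L) (v : ι → H) :
    IsUnit (regCov L v) := by
  refine isUnit_of_coercive _ hL fun u => ?_
  rw [inner_regCov_self]
  have : 0 ≤ ∑ i, inner ℝ (v i) u ^ 2 := Finset.sum_nonneg fun i _ => sq_nonneg _
  linarith

/-- The inverse of `regCov`. -/
def regRes {ι : Type*} [Fintype ι] (L : ℝ) (v : ι → H) : H →L[ℝ] H := Ring.inverse (regCov L v)

variable {ι : Type*} [Fintype ι] {L : ℝ}

theorem regCov_regRes (hL : 0 < L) (v : ι → H) (u : H) : regCov L v (regRes L v u) = u :=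
  self_apply_inverse (isUnit_regCov hL v) u

theorem regRes_regCov (hL : 0 < L) (v : ι → H) (u : H) : regRes L v (regCov L v u) = u :=
  inverse_apply_self (isUnit_regCov hL v) u

theorem continuous_regRes (hL : 0 < L) : Continuous fun v : ι → H => regRes L v := by
  refine continuous_iff_continuousAt.2 fun v => ?_
  have h := (isUnit_regCov hL v)
  obtain ⟨a, ha⟩ := h
  have h1 : ContinuousAt Ring.inverse (regCov L v) := ha ▸ NormedRing.inverse_continuousAt a
  exact ContinuousAt.comp (f := fun v : ι → H => regCov L v) h1 (continuous_regCov L).continuousAt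

theorem inner_regRes_comm (hL : 0 < L) (v : ι → H) (u w : H) :
    inner ℝ (regRes L v u) w = inner ℝ u (regRes L v w) := by
  refine inner_inverse_comm (isUnit_regCov hL v) (fun a b => ?_) u w
  rw [real_inner_comm (regCov L v b) a, inner_regCov, inner_regCov, real_inner_comm a b]
  simp only [mul_comm]

theorem inner_regRes_self (hL : 0 < L) (v : ι → H) (w : H) :
    inner ℝ w (regRes L v w) =
      L * ‖regRes L v w‖ ^ 2 + ∑ i, inner ℝ (v i) (regRes L v w) ^ 2 := by
  rw [← inner_regCov_self, regCov_regRes hL]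

theorem inner_regRes_nonneg (hL : 0 < L) (v : ι → H) (w : H) :
    0 ≤ inner ℝ w (regRes L v w) := by
  rw [inner_regRes_self hL]
  have : 0 ≤ ∑ i, inner ℝ (v i) (regRes L v w) ^ 2 := Finset.sum_nonneg fun i _ => sq_nonneg _
  positivity

/-- The right side is a ridge functional of `a`, and the left side is its minimum, attained at `aᵢ =
⟨vᵢ, p⟩` with `p = regRes L v w`. Only the inequality is needed: it allows arbitrary test
coefficients. Pairing `p` with `w = q + ∑ aᵢ vᵢ` and applying Young's inequality to both parts gives
it. -/
theorem mul_inner_regRes_le (hL : 0 < L) (v : ι → H) (w : H) (a : ι → ℝ) :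
    L * inner ℝ w (regRes L v w) ≤ ‖w - ∑ i, a i • v i‖ ^ 2 + L * ∑ i, a i ^ 2 := by
  have h1 := inner_regRes_self hL v w
  set p := regRes L v w
  set q := w - ∑ i, a i • v i with hq
  have h2 : inner ℝ w p = inner ℝ q p + ∑ i, a i * inner ℝ (v i) p := by
    simp [hq, inner_sub_left, sum_inner, real_inner_smul_left]
  have h3 : 2 * L * inner ℝ q p ≤ ‖q‖ ^ 2 + L ^ 2 * ‖p‖ ^ 2 := by
    have := real_inner_le_norm q p
    nlinarith [sq_nonneg (‖q‖ - L * ‖p‖), mul_le_mul_of_nonneg_left this hL.le]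
  have h4 : 2 * ∑ i, a i * inner ℝ (v i) p ≤ ∑ i, a i ^ 2 + ∑ i, inner ℝ (v i) p ^ 2 := by
    rw [Finset.mul_sum, ← Finset.sum_add_distrib]
    exact Finset.sum_le_sum fun i _ => by nlinarith [sq_nonneg (a i - inner ℝ (v i) p)]
  nlinarith [mul_le_mul_of_nonneg_left h4 hL.le]

theorem mul_inner_regRes_le_norm_sq (hL : 0 < L) (v : ι → H) (w : H) :
    L * inner ℝ w (regRes L v w) ≤ ‖w‖ ^ 2 := by
  simpa using mul_inner_regRes_le hL v w 0

/-- With `V V* = ∑ vᵢ ⊗ vᵢ`, this is `R V V* R ≤ R (L + V V*) R = R` as quadratic forms. -/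
theorem sum_inner_regRes_sq_le (hL : 0 < L) (v : ι → H) (w : H) :
    ∑ i, inner ℝ w (regRes L v (v i)) ^ 2 ≤ inner ℝ w (regRes L v w) := by
  rw [inner_regRes_self hL]
  have : ∀ i, inner ℝ w (regRes L v (v i)) = inner ℝ (v i) (regRes L v w) := fun i => by
    rw [← inner_regRes_comm hL, real_inner_comm]
  simp only [this]
  nlinarith [mul_nonneg hL.le (sq_nonneg ‖regRes L v w‖)]

/-- For `p = regRes L v h` the sum equals `⟨h, p⟩ - L‖p‖²`; completing the square gives the constant
`1/(4L)`. The bound does not depend on the number of vectors. -/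
theorem sum_sq_inner_regRes_le (hL : 0 < L) (v : ι → H) (h : H) :
    4 * L * ∑ i, inner ℝ (v i) (regRes L v h) ^ 2 ≤ ‖h‖ ^ 2 := by
  have h1 := inner_regRes_self hL v h
  set p := regRes L v h
  have := mul_le_mul_of_nonneg_left (real_inner_le_norm h p) hL.le
  nlinarith [sq_nonneg (‖h‖ - 2 * L * ‖p‖)]

/-- Sherman-Morrison for the rank one update by `w`, tested against `w` itself. -/
theorem inner_regRes_insertNth {n : ℕ} (hL : 0 < L) (v : Fin n → H) (i : Fin (n + 1)) (w h : H) :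
    inner ℝ w (regRes L v h) = (1 + inner ℝ w (regRes L v w)) *
      inner ℝ w (regRes L (i.insertNth (α := fun _ => H) w v) h) := by
  set v' := i.insertNth (α := fun _ => H) w v
  have h1 : h = regCov L v (regRes L v' h) + inner ℝ w (regRes L v' h) • w := by
    rw [← regCov_insertNth L v i, regCov_regRes hL]
  have h2 : regRes L v h = regRes L v' h + inner ℝ w (regRes L v' h) • regRes L v w := by
    conv_lhs => rw [h1]
    rw [map_add, regRes_regCov hL, map_smul]
  rw [h2, inner_add_right, real_inner_smul_right]
  ring

end Resolvent

/-! ### Expectations over a sample -/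

section Sample

theorem _root_.Continuous.integrable_of_compactSpace {α E : Type*} [TopologicalSpace α]
    [CompactSpace α] [MeasurableSpace α] [OpensMeasurableSpace α] [NormedAddCommGroup E]
    [SecondCountableTopologyEither α E] {f : α → E} (hf : Continuous f)
    (μ : Measure α) [IsFiniteMeasure μ] : Integrable f μ :=
  hf.integrable_of_hasCompactSupport (HasCompactSupport.of_compactSpace f)

theorem _root_.Fin.continuous_insertNth_const {Z : Type*} [TopologicalSpace Z] {n : ℕ}
    (i : Fin (n + 1)) :
    Continuous fun p : Z × (Fin n → Z) => i.insertNth (α := fun _ => Z) p.1 p.2 :=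
  Continuous.finInsertNth (A := fun _ => Z) i continuous_fst continuous_snd

variable {Z : Type*} [TopologicalSpace Z] [CompactSpace Z] [SecondCountableTopology Z]
  [MeasurableSpace Z] [BorelSpace Z] (P : Measure Z) [IsProbabilityMeasure P]

theorem integral_pi_insertNth {n : ℕ} (i : Fin (n + 1)) {F : (Fin (n + 1) → Z) → ℝ}
    (hF : Continuous F) :
    ∫ z, F z ∂(Measure.pi fun _ : Fin (n + 1) => P) =
      ∫ w, ∫ z', F (i.insertNth (α := fun _ => Z) w z') ∂(Measure.pi fun _ : Fin n => P) ∂P := by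
  have h := (measurePreserving_piFinSuccAbove (fun _ : Fin (n + 1) => P) i).symm
  rw [← h.integral_comp', integral_prod]
  · rfl
  · refine Continuous.integrable_of_compactSpace ?_ _
    exact hF.comp (Fin.continuous_insertNth_const i)

variable {H : Type*} [NormedAddCommGroup H] [InnerProductSpace ℝ H] [CompleteSpace H]

/-- Independent centred vectors are orthogonal in mean. The free shift `c` makes the induction work:
it absorbs the coordinate that is split off. -/
theorem integral_norm_add_sum_sq {ζ : Z → H} (hζ : Continuous ζ) (h0 : ∫ w, ζ w ∂P = 0) (n : ℕ)
    (c : H) :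
    ∫ z, ‖c + ∑ j, ζ (z j)‖ ^ 2 ∂(Measure.pi fun _ : Fin n => P) =
      ‖c‖ ^ 2 + n * ∫ w, ‖ζ w‖ ^ 2 ∂P := by
  induction n generalizing c with
  | zero => simp
  | succ n ih =>
    have hi : ∀ {f : Z → ℝ}, Continuous f → Integrable f P :=
      fun hf => hf.integrable_of_compactSpace P
    rw [integral_pi_insertNth P 0 (by fun_prop)]
    have h1 : ∀ w : Z, ∫ z', ‖c + ∑ j, ζ ((0 : Fin (n + 1)).insertNth (α := fun _ => Z) w z' j)‖ ^ 2
        ∂(Measure.pi fun _ : Fin n => P) = ‖c + ζ w‖ ^ 2 + n * ∫ w, ‖ζ w‖ ^ 2 ∂P := fun w => by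
      rw [← ih (c + ζ w)]
      refine integral_congr_ae (.of_forall fun z' => ?_)
      simp [Fin.sum_univ_succ, add_assoc]
    have h2 : ∫ w, inner ℝ c (ζ w) ∂P = 0 := by
      rw [integral_inner (hζ.integrable_of_compactSpace P), h0, inner_zero_right]
    simp only [h1]
    simp only [norm_add_sq_real]
    rw [integral_add (hi (by fun_prop)) (hi (by fun_prop)),
      integral_add (hi (by fun_prop)) (hi (by fun_prop)),
      integral_add (hi (by fun_prop)) (hi (by fun_prop)), integral_const_mul, h2]
    simp
    ring

variable {κ L : ℝ} {n : ℕ}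

/-- The ridge problem for `v` is tested with the random coefficients `⟨ψ(z_j), u⟩ / n`, whose
combination of the `ψ(z_j)` is an unbiased estimate of `Σ u`. The `κ²` term is the variance of this
estimate and the extra `L` is the penalty on the coefficients. -/
theorem integral_inner_regRes_le {ψ : Z → H} (hψ : Continuous ψ) (hκ : ∀ z, ‖ψ z‖ ≤ κ)
    (hn : 0 < n) (hL : 0 < L) (v u : H) :
    L * ∫ z, inner ℝ v (regRes L (fun j => ψ (z j)) v) ∂(Measure.pi fun _ : Fin n => P) ≤
      ‖v - ∫ w, inner ℝ (ψ w) u • ψ w ∂P‖ ^ 2 +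
        (κ ^ 2 + L) / n * ∫ w, inner ℝ (ψ w) u ^ 2 ∂P := by
  set m := ∫ w, inner ℝ (ψ w) u • ψ w ∂P with hm
  set q := ∫ w, inner ℝ (ψ w) u ^ 2 ∂P with hq
  have hn' : (0 : ℝ) < n := by exact_mod_cast hn
  have hi : ∀ {f : Z → ℝ}, Continuous f → Integrable f P :=
    fun hf => hf.integrable_of_compactSpace P
  have hI : ∀ {f : (Fin n → Z) → ℝ}, Continuous f → Integrable f (Measure.pi fun _ : Fin n => P) :=
    fun hf => hf.integrable_of_compactSpace _
  -- Centred and scaled so that the residual of the test coefficients is exactly `(v - m) + ∑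
  -- ζ(z_j)`.
  set ζ : Z → H := fun w => (1 / (n : ℝ)) • (m - inner ℝ (ψ w) u • ψ w) with hζ
  have hζc : Continuous ζ := by fun_prop
  have hξi : Integrable (fun w => inner ℝ (ψ w) u • ψ w) P :=
    Continuous.integrable_of_compactSpace (by fun_prop) P
  have hζ0 : ∫ w, ζ w ∂P = 0 := by
    rw [integral_smul, integral_sub (integrable_const m) hξi, ← hm]
    simp
  have hζ2 : ∫ w, ‖ζ w‖ ^ 2 ∂P ≤ κ ^ 2 * q / n ^ 2 := by
    have h1 : ∀ w, ‖ζ w‖ ^ 2 = (1 / (n : ℝ)) ^ 2 * (‖m‖ ^ 2 - 2 * inner ℝ m (inner ℝ (ψ w) u • ψ w)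
        + inner ℝ (ψ w) u ^ 2 * ‖ψ w‖ ^ 2) := fun w => by
      rw [hζ]
      simp only [norm_smul, mul_pow, norm_sub_sq_real, Real.norm_eq_abs, sq_abs]
    have h2 : ∫ w, inner ℝ m (inner ℝ (ψ w) u • ψ w) ∂P = ‖m‖ ^ 2 := by
      rw [integral_inner hξi, ← hm, real_inner_self_eq_norm_sq]
    have h3 : ∫ w, inner ℝ (ψ w) u ^ 2 * ‖ψ w‖ ^ 2 ∂P ≤ κ ^ 2 * q := by
      rw [hq, ← integral_const_mul]
      refine integral_mono (hi (by fun_prop)) (hi (by fun_prop)) fun w => ?_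
      have : ‖ψ w‖ ^ 2 ≤ κ ^ 2 := pow_le_pow_left₀ (norm_nonneg _) (hκ w) 2
      nlinarith [mul_le_mul_of_nonneg_left this (sq_nonneg (inner ℝ (ψ w) u))]
    simp only [h1]
    rw [integral_const_mul, integral_add (hi (by fun_prop)) (hi (by fun_prop)),
      integral_sub (hi (by fun_prop)) (hi (by fun_prop)), integral_const_mul, h2]
    rw [integral_const, probReal_univ, one_smul]
    have h4 : κ ^ 2 * q / n ^ 2 = (1 / (n : ℝ)) ^ 2 * (κ ^ 2 * q) := by ring
    rw [h4]
    refine mul_le_mul_of_nonneg_left ?_ (by positivity)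
    -- The variance is at most the second moment: the term `-‖m‖²` is dropped.
    nlinarith [sq_nonneg ‖m‖]
  have hpt : ∀ z : Fin n → Z, L * inner ℝ v (regRes L (fun j => ψ (z j)) v) ≤
      ‖(v - m) + ∑ j, ζ (z j)‖ ^ 2 + L / n ^ 2 * ∑ j, inner ℝ (ψ (z j)) u ^ 2 := fun z => by
    refine (mul_inner_regRes_le hL (fun j => ψ (z j)) v
      fun j => (1 / (n : ℝ)) * inner ℝ (ψ (z j)) u).trans (le_of_eq ?_)
    congr 1
    · congr 2
      simp only [hζ, smul_sub, Finset.sum_sub_distrib, smul_smul]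
      simp only [Finset.sum_const, Finset.card_univ, Fintype.card_fin, ← Nat.cast_smul_eq_nsmul ℝ,
        smul_smul]
      rw [mul_one_div_cancel hn'.ne', one_smul]
      abel
    · simp only [mul_pow, ← Finset.mul_sum]
      ring
  have hsum : ∫ z : Fin n → Z, ∑ j, inner ℝ (ψ (z j)) u ^ 2 ∂(Measure.pi fun _ : Fin n => P) =
      n * q := by
    rw [integral_finsetSum _ fun j _ => hI (by fun_prop)]
    have : ∀ j : Fin n, ∫ z : Fin n → Z, inner ℝ (ψ (z j)) u ^ 2 ∂(Measure.pi fun _ : Fin n => P) =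
        q := fun j => by
      exact integral_comp_eval (μ := fun _ : Fin n => P) (i := j)
        (f := fun w => inner ℝ (ψ w) u ^ 2) (hi (by fun_prop)).aestronglyMeasurable
    simp [this]
  have hcont : Continuous fun z : Fin n → Z => regRes L (fun j => ψ (z j)) :=
    (continuous_regRes hL).comp (by fun_prop)
  rw [← integral_const_mul]
  refine (integral_mono (hI ?_) (hI ?_) hpt).trans ?_
  · fun_prop
  · fun_prop
  rw [integral_add (hI (by fun_prop)) (hI (by fun_prop)), integral_norm_add_sum_sq P hζc hζ0,
    integral_const_mul, hsum]
  have h5 : (n : ℝ) * ∫ w, ‖ζ w‖ ^ 2 ∂P ≤ n * (κ ^ 2 * q / n ^ 2) :=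
    mul_le_mul_of_nonneg_left hζ2 hn'.le
  have h6 : (n : ℝ) * (κ ^ 2 * q / n ^ 2) + L / n ^ 2 * (n * q) = (κ ^ 2 + L) / n * q := by
    field_simp
  linarith

/-- For `u = (Σ + λ)⁻¹ v` the deterministic residual `v - Σ u` is `λ u`, and the last factor on the
right is `⟨v, (Σ + λ)⁻¹ v⟩`. -/
theorem mul_integral_inner_regRes_le {ψ : Z → H} (hψ : Continuous ψ) (hκ : ∀ z, ‖ψ z‖ ≤ κ)
    (hn : 0 < n) {lam : ℝ} (hlam : 0 < lam) {v u : H}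
    (hu : v = (∫ w, inner ℝ (ψ w) u • ψ w ∂P) + lam • u) :
    n * ∫ z, inner ℝ v (regRes (n * lam) (fun j => ψ (z j)) v) ∂(Measure.pi fun _ : Fin n => P) ≤
      (1 + κ ^ 2 / (n * lam)) * (lam * ‖u‖ ^ 2 + ∫ w, inner ℝ (ψ w) u ^ 2 ∂P) := by
  have hn' : (0 : ℝ) < n := by exact_mod_cast hn
  have h := integral_inner_regRes_le P hψ hκ hn (mul_pos hn' hlam) v u
  have hq : 0 ≤ ∫ w, inner ℝ (ψ w) u ^ 2 ∂P := integral_nonneg fun w => sq_nonneg _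
  set q := ∫ w, inner ℝ (ψ w) u ^ 2 ∂P
  have h1 : v - (∫ w, inner ℝ (ψ w) u • ψ w ∂P) = lam • u := by
    rw [sub_eq_iff_eq_add']; exact hu
  rw [h1, norm_smul, mul_pow, Real.norm_eq_abs, sq_abs] at h
  set I := ∫ z, inner ℝ v (regRes (n * lam) (fun j => ψ (z j)) v) ∂(Measure.pi fun _ : Fin n => P)
  have h2 : n * I ≤ lam * ‖u‖ ^ 2 + (κ ^ 2 / (n * lam) + 1) * q := by
    have : lam * (n * I) ≤ lam * (lam * ‖u‖ ^ 2 + (κ ^ 2 / (n * lam) + 1) * q) := by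
      calc _ = n * lam * I := by ring
        _ ≤ _ := h
        _ = _ := by field_simp
    exact le_of_mul_le_mul_left this hlam
  have h3 : 0 ≤ κ ^ 2 / (n * lam) * (lam * ‖u‖ ^ 2) := by positivity
  nlinarith

/-- The resolvent sees the sample only through `π`. In an off-diagonal product, with every
coordinate but the `j`th frozen, `ε (z j)` is multiplied by a continuous function of `π (z j)`, so
`horth` kills it. The diagonal is controlled by `R V V* R ≤ R`. -/
theorem integral_inner_regRes_noise_sq_le {X : Type*} [TopologicalSpace X] {φ : X → H}
    (hφ : Continuous φ) {π : Z → X} (hπ : Continuous π) {ε : Z → ℝ} (hε : Continuous ε) {B : ℝ}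
    (hB : ∀ z, |ε z| ≤ B)
    (horth : ∀ g : X → ℝ, Continuous g → ∫ z, ε z * g (π z) ∂P = 0) (hL : 0 < L) (v : H) :
    ∫ z, inner ℝ v (regRes L (fun j => φ (π (z j))) (∑ j, ε (z j) • φ (π (z j)))) ^ 2
        ∂(Measure.pi fun _ : Fin n => P) ≤
      B ^ 2 * ∫ z, inner ℝ v (regRes L (fun j => φ (π (z j))) v)
        ∂(Measure.pi fun _ : Fin n => P) := by
  have hI : ∀ {f : (Fin n → Z) → ℝ}, Continuous f → Integrable f (Measure.pi fun _ : Fin n => P) :=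
    fun hf => hf.integrable_of_compactSpace _
  set a : Fin n → (Fin n → X) → ℝ := fun j x => inner ℝ v (regRes L (fun i => φ (x i)) (φ (x j)))
    with ha
  have hres : Continuous fun x : Fin n → X => regRes L (fun j => φ (x j)) :=
    (continuous_regRes hL).comp (by fun_prop)
  have hac : ∀ j, Continuous (a j) := fun j => by
    simp only [ha]
    fun_prop
  have hexp : ∀ z : Fin n → Z,
      inner ℝ v (regRes L (fun j => φ (π (z j))) (∑ j, ε (z j) • φ (π (z j)))) ^ 2 =
        ∑ j, ∑ l, (ε (z j) * a j (fun i => π (z i))) * (ε (z l) * a l (fun i => π (z i))) :=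
    fun z => by
      rw [sq, ← Finset.sum_mul_sum]
      simp only [map_sum, map_smul, inner_sum, real_inner_smul_right, ha]
  have hoff : ∀ j l : Fin n, j ≠ l → ∫ z : Fin n → Z,
      (ε (z j) * a j (fun i => π (z i))) * (ε (z l) * a l (fun i => π (z i)))
        ∂(Measure.pi fun _ : Fin n => P) = 0 := by
    intro j l hjl
    obtain _ | m := n
    · exact j.elim0
    obtain ⟨l', rfl⟩ := Fin.exists_succAbove_eq hjl.symm
    -- The swap makes coordinate `j` the inner variable, so that `horth` applies for each fixed
    -- remainder of the sample.
    rw [integral_pi_insertNth P j (by fun_prop), integral_integral_swap]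
    · refine integral_eq_zero_of_ae (.of_forall fun z' => ?_)
      set g : X → ℝ := fun x => a j (j.insertNth (α := fun _ => X) x fun i => π (z' i)) *
        (ε (z' l') * a (j.succAbove l') (j.insertNth (α := fun _ => X) x fun i => π (z' i))) with hg
      have hgc : Continuous g := by
        have : Continuous fun x : X => j.insertNth (α := fun _ => X) x fun i => π (z' i) :=
          (Fin.continuous_insertNth_const j).comp
            (f := fun x : X => (x, fun i => π (z' i))) (by fun_prop)
        fun_prop
      refine Eq.trans (integral_congr_ae (.of_forall fun w => ?_)) (horth g hgc)
      have : (fun i => π (j.insertNth (α := fun _ => Z) w z' i)) =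
          j.insertNth (α := fun _ => X) (π w) fun i => π (z' i) := by
        funext i
        refine Fin.succAboveCases j ?_ (fun i => ?_) i <;> simp
      simp only [hg, this, Fin.insertNth_apply_same, Fin.insertNth_apply_succAbove]
      ring
    · refine Continuous.integrable_of_compactSpace ?_ _
      have : Continuous fun p : Z × (Fin m → Z) => j.insertNth (α := fun _ => Z) p.1 p.2 :=
        Fin.continuous_insertNth_const j
      have h' : ∀ i, Continuous fun p : Z × (Fin m → Z) =>
          j.insertNth (α := fun _ => Z) p.1 p.2 i := fun i => (continuous_apply i).comp this
      simp only [Function.uncurry_def]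
      fun_prop
  simp only [hexp]
  rw [integral_finsetSum _ fun j _ => hI (by fun_prop), ← integral_const_mul]
  have hdiag : ∀ j : Fin n, ∫ z : Fin n → Z, ∑ l,
      (ε (z j) * a j (fun i => π (z i))) * (ε (z l) * a l (fun i => π (z i)))
        ∂(Measure.pi fun _ : Fin n => P) = ∫ z : Fin n → Z, (ε (z j) * a j (fun i => π (z i))) ^ 2
        ∂(Measure.pi fun _ : Fin n => P) := fun j => by
    rw [integral_finsetSum _ fun l _ => hI (by fun_prop),
      Finset.sum_eq_single j (fun l _ hl => hoff j l hl.symm) (by simp)]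
    simp only [sq]
  simp only [hdiag]
  rw [← integral_finsetSum _ fun j _ => hI (by fun_prop)]
  have hres' : Continuous fun z : Fin n → Z => regRes L (fun j => φ (π (z j))) :=
    (continuous_regRes hL).comp (by fun_prop)
  refine integral_mono (hI (by fun_prop)) (hI (by fun_prop)) fun z => ?_
  refine le_trans ?_ (mul_le_mul_of_nonneg_left
    (sum_inner_regRes_sq_le hL (fun j => φ (π (z j))) v) (sq_nonneg B))
  rw [Finset.mul_sum]
  refine Finset.sum_le_sum fun j _ => ?_
  rw [mul_pow]
  exact mul_le_mul_of_nonneg_right (sq_le_sq' (abs_le.1 (hB _)).1 (abs_le.1 (hB _)).2)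
    (sq_nonneg _)

/-- The test point `w` and the `n` sample points form an exchangeable sample of size `n + 1`.
Enlarging the resolvent by `w` costs the factor `1 + ⟨ψ w, R ψ w⟩ ≤ 1 + κ²/L`; summing over the `n +
1` possible positions of `w` gives an in-sample sum to which `sum_sq_inner_regRes_le` applies
pointwise. -/
theorem integral_inner_regRes_bias_sq_le {ψ : Z → H} (hψ : Continuous ψ) (hκ : ∀ z, ‖ψ z‖ ≤ κ)
    (hL : 0 < L) (h : H) :
    4 * L * (n + 1) * ∫ w, ∫ z, inner ℝ (ψ w) (regRes L (fun j => ψ (z j)) h) ^ 2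
        ∂(Measure.pi fun _ : Fin n => P) ∂P ≤ (1 + κ ^ 2 / L) ^ 2 * ‖h‖ ^ 2 := by
  have hres : ∀ n, Continuous fun z : Fin n → Z => regRes L (fun j => ψ (z j)) := fun n =>
    (continuous_regRes hL).comp (by fun_prop)
  have hres1 : Continuous fun p : Z × (Fin n → Z) => regRes L (fun j => ψ (p.2 j)) :=
    (hres n).comp continuous_snd
  have hres2 := hres (n + 1)
  set C := (1 + κ ^ 2 / L) ^ 2 with hC
  have hI : ∀ {f : (Fin (n + 1) → Z) → ℝ}, Continuous f →
      Integrable f (Measure.pi fun _ : Fin (n + 1) => P) := fun hf => hf.integrable_of_compactSpace _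
  have hI' : ∀ {f : Z × (Fin n → Z) → ℝ}, Continuous f →
      Integrable f (P.prod (Measure.pi fun _ : Fin n => P)) :=
    fun hf => hf.integrable_of_compactSpace _
  have hstep : ∀ i : Fin (n + 1), ∫ w, ∫ z, inner ℝ (ψ w) (regRes L (fun j => ψ (z j)) h) ^ 2
      ∂(Measure.pi fun _ : Fin n => P) ∂P ≤
      C * ∫ z, inner ℝ (ψ (z i)) (regRes L (fun j => ψ (z j)) h) ^ 2
        ∂(Measure.pi fun _ : Fin (n + 1) => P) := fun i => by
    rw [integral_pi_insertNth P i (by fun_prop), ← integral_const_mul]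
    simp only [← integral_const_mul]
    have hins : Continuous fun p : Z × (Fin n → Z) => i.insertNth (α := fun _ => Z) p.1 p.2 :=
      Fin.continuous_insertNth_const i
    have hins' : ∀ j, Continuous fun p : Z × (Fin n → Z) =>
          i.insertNth (α := fun _ => Z) p.1 p.2 j := fun j => (continuous_apply j).comp hins
    have hins2 : Continuous fun p : Z × (Fin n → Z) =>
        regRes L (fun j => ψ (i.insertNth (α := fun _ => Z) p.1 p.2 j)) := hres2.comp hins
    rw [← integral_prod (fun p : Z × (Fin n → Z) =>
        inner ℝ (ψ p.1) (regRes L (fun j => ψ (p.2 j)) h) ^ 2) (hI' (by fun_prop)),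
      ← integral_prod (fun p : Z × (Fin n → Z) =>
        C * inner ℝ (ψ (i.insertNth (α := fun _ => Z) p.1 p.2 i))
          (regRes L (fun j => ψ (i.insertNth (α := fun _ => Z) p.1 p.2 j)) h) ^ 2)
        (hI' (by fun_prop))]
    refine integral_mono (hI' (by fun_prop)) (hI' (by fun_prop)) fun p => ?_
    have h1 := inner_regRes_insertNth hL (fun j => ψ (p.2 j)) i (ψ p.1) h
    have h2 : (fun j => ψ (i.insertNth (α := fun _ => Z) p.1 p.2 j)) =
        i.insertNth (α := fun _ => H) (ψ p.1) fun j => ψ (p.2 j) := by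
      funext j
      refine Fin.succAboveCases i ?_ (fun j => ?_) j <;> simp
    simp only [h2, Fin.insertNth_apply_same]
    rw [h1, mul_pow, hC]
    refine mul_le_mul_of_nonneg_right ?_ (sq_nonneg _)
    have h3 := inner_regRes_nonneg hL (fun j => ψ (p.2 j)) (ψ p.1)
    have h4 := mul_inner_regRes_le_norm_sq hL (fun j => ψ (p.2 j)) (ψ p.1)
    refine pow_le_pow_left₀ (by positivity) (add_le_add_right ?_ 1) 2
    rw [le_div_iff₀ hL, mul_comm]
    exact h4.trans (pow_le_pow_left₀ (norm_nonneg _) (hκ _) 2)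
  have hsum := Finset.sum_le_sum fun i (_ : i ∈ Finset.univ) => hstep i
  rw [← Finset.mul_sum, ← integral_finsetSum _ fun i _ => hI (by fun_prop)] at hsum
  simp only [Finset.sum_const, Finset.card_univ, Fintype.card_fin, nsmul_eq_mul, Nat.cast_add,
    Nat.cast_one] at hsum
  have hfin : 4 * L * ∫ z, ∑ i, inner ℝ (ψ (z i)) (regRes L (fun j => ψ (z j)) h) ^ 2
        ∂(Measure.pi fun _ : Fin (n + 1) => P) ≤ ‖h‖ ^ 2 := by
    rw [← integral_const_mul]
    refine (integral_mono (hI (by fun_prop)) (integrable_const (‖h‖ ^ 2)) fun z =>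
      sum_sq_inner_regRes_le hL (fun j => ψ (z j)) h).trans (by simp)
  have hC0 : 0 ≤ C := sq_nonneg _
  nlinarith [mul_le_mul_of_nonneg_left hfin hC0]

theorem integrable_sq_error {X : Type*} [TopologicalSpace X] {φ : X → H} (hφ : Continuous φ)
    {π : Z → X} (hπ : Continuous π) {ε : Z → ℝ} (hε : Continuous ε) (hL : 0 < L) (h : H) :
    Integrable (fun z : Fin n → Z => ∫ w, inner ℝ (φ (π w)) (regRes L (fun j => φ (π (z j)))
      (∑ j, ε (z j) • φ (π (z j))) - L • regRes L (fun j => φ (π (z j))) h) ^ 2 ∂P)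
      (Measure.pi fun _ : Fin n => P) := by
  have hres : Continuous fun z : Fin n → Z => regRes L (fun j => φ (π (z j))) :=
    (continuous_regRes hL).comp (by fun_prop)
  have hres' : Continuous fun p : (Fin n → Z) × Z => regRes L (fun j => φ (π (p.1 j))) :=
    hres.comp continuous_fst
  exact Integrable.integral_prod_left
    (f := fun p : (Fin n → Z) × Z => inner ℝ (φ (π p.2)) (regRes L (fun j => φ (π (p.1 j)))
      (∑ j, ε (p.1 j) • φ (π (p.1 j))) - L • regRes L (fun j => φ (π (p.1 j))) h) ^ 2)
    (Continuous.integrable_of_compactSpace (by fun_prop) _)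

/-- The mean squared error of regularized least squares in a Hilbert space, where `u w` solves
`(Σ + lam) (u w) = ψ w` for the covariance operator `Σ`. -/
theorem integral_sq_error_le {X : Type*} [TopologicalSpace X] {φ : X → H}
    (hφ : Continuous φ) (hκ : ∀ x, ‖φ x‖ ≤ κ) {π : Z → X} (hπ : Continuous π) {ε : Z → ℝ}
    (hε : Continuous ε) {B : ℝ} (hB : ∀ z, |ε z| ≤ B)
    (horth : ∀ g : X → ℝ, Continuous g → ∫ z, ε z * g (π z) ∂P = 0) (hn : 0 < n) {lam : ℝ}
    (hlam : 0 < lam) (h : H) {u : X → H} (huc : Continuous u)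
    (hu : ∀ x, φ x = (∫ w, inner ℝ (φ (π w)) (u x) • φ (π w) ∂P) + lam • u x) :
    ∫ z, ∫ w, inner ℝ (φ (π w)) (regRes (n * lam) (fun j => φ (π (z j)))
        (∑ j, ε (z j) • φ (π (z j))) - (n * lam) • regRes (n * lam) (fun j => φ (π (z j))) h) ^ 2
        ∂P ∂(Measure.pi fun _ : Fin n => P) ≤
      2 * B ^ 2 * (1 + κ ^ 2 / (n * lam)) / n *
        ∫ w, (lam * ‖u (π w)‖ ^ 2 + ∫ w', inner ℝ (φ (π w')) (u (π w)) ^ 2 ∂P) ∂P +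
      (1 + κ ^ 2 / (n * lam)) ^ 2 * lam * ‖h‖ ^ 2 := by
  have hn' : (0 : ℝ) < n := by exact_mod_cast hn
  have hL : 0 < n * lam := mul_pos hn' hlam
  set L := n * lam with hLdef
  have hres : Continuous fun z : Fin n → Z => regRes L (fun j => φ (π (z j))) :=
    (continuous_regRes hL).comp (by fun_prop)
  have hres' : Continuous fun p : Z × (Fin n → Z) => regRes L (fun j => φ (π (p.2 j))) :=
    hres.comp continuous_snd
  have hres'' : Continuous fun p : (Fin n → Z) × Z => regRes L (fun j => φ (π (p.1 j))) :=
    hres.comp continuous_fst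
  have hI' : ∀ {f : Z × (Fin n → Z) → ℝ}, Continuous f →
      Integrable f (P.prod (Measure.pi fun _ : Fin n => P)) :=
    fun hf => hf.integrable_of_compactSpace _
  set D : Z × (Fin n → Z) → ℝ := fun p => inner ℝ (φ (π p.1)) (regRes L (fun j => φ (π (p.2 j)))
    (∑ j, ε (p.2 j) • φ (π (p.2 j)))) ^ 2 with hD
  set E : Z × (Fin n → Z) → ℝ := fun p =>
    inner ℝ (φ (π p.1)) (regRes L (fun j => φ (π (p.2 j))) h) ^ 2 with hE
  have hDc : Continuous D := by simp only [hD]; fun_prop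
  have hEc : Continuous E := by simp only [hE]; fun_prop
  have hswap := integral_integral_swap (μ := Measure.pi fun _ : Fin n => P) (ν := P)
    (f := fun z w => inner ℝ (φ (π w)) (regRes L (fun j => φ (π (z j)))
        (∑ j, ε (z j) • φ (π (z j))) - L • regRes L (fun j => φ (π (z j))) h) ^ 2)
    (Continuous.integrable_of_compactSpace (by simp only [Function.uncurry_def]; fun_prop) _)
  rw [hswap, ← integral_prod (fun p : Z × (Fin n → Z) => inner ℝ (φ (π p.1))
      (regRes L (fun j => φ (π (p.2 j))) (∑ j, ε (p.2 j) • φ (π (p.2 j))) -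
        L • regRes L (fun j => φ (π (p.2 j))) h) ^ 2) (hI' (by fun_prop))]
  have h1 : ∫ p, inner ℝ (φ (π p.1))
      (regRes L (fun j => φ (π (p.2 j))) (∑ j, ε (p.2 j) • φ (π (p.2 j))) -
        L • regRes L (fun j => φ (π (p.2 j))) h) ^ 2 ∂(P.prod (Measure.pi fun _ : Fin n => P)) ≤
      2 * ∫ p, D p ∂(P.prod (Measure.pi fun _ : Fin n => P)) +
      2 * L ^ 2 * ∫ p, E p ∂(P.prod (Measure.pi fun _ : Fin n => P)) := by
    rw [← integral_const_mul, ← integral_const_mul,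
      ← integral_add ((hI' hDc).const_mul _) ((hI' hEc).const_mul _)]
    refine integral_mono (hI' (by fun_prop)) (hI' (by fun_prop)) fun p => ?_
    simp only [inner_sub_right, real_inner_smul_right, hD, hE]
    set s := inner ℝ (φ (π p.1)) (regRes L (fun j => φ (π (p.2 j)))
      (∑ j, ε (p.2 j) • φ (π (p.2 j))))
    set t := inner ℝ (φ (π p.1)) (regRes L (fun j => φ (π (p.2 j))) h)
    -- Noise and bias are separated by `(s - L t)² ≤ 2 s² + 2 L² t²`.
    nlinarith [sq_nonneg (s + L * t)]
  refine h1.trans (add_le_add ?_ ?_)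
  · rw [integral_prod _ (hI' hDc)]
    have h2 : ∀ w, ∫ z, D (w, z) ∂(Measure.pi fun _ : Fin n => P) ≤
        B ^ 2 * (1 + κ ^ 2 / L) / n *
          (lam * ‖u (π w)‖ ^ 2 + ∫ w', inner ℝ (φ (π w')) (u (π w)) ^ 2 ∂P) := fun w => by
      refine (integral_inner_regRes_noise_sq_le P hφ hπ hε hB horth hL (φ (π w))).trans ?_
      have h3 := mul_integral_inner_regRes_le P (hφ.comp hπ) (fun z => hκ (π z)) hn hlam (hu (π w))
      simp only [Function.comp_apply] at h3
      rw [← hLdef] at h3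
      rw [mul_div_assoc, mul_assoc]
      refine mul_le_mul_of_nonneg_left ?_ (sq_nonneg B)
      rw [div_mul_eq_mul_div, le_div_iff₀ hn', mul_comm]
      exact h3
    have hqi : Integrable (fun w => ∫ w', inner ℝ (φ (π w')) (u (π w)) ^ 2 ∂P) P :=
      Integrable.integral_prod_left (f := fun p : Z × Z => inner ℝ (φ (π p.2)) (u (π p.1)) ^ 2)
        (Continuous.integrable_of_compactSpace (by fun_prop) (P.prod P))
    have h4 := integral_mono (hI' hDc).integral_prod_left
      (((Continuous.integrable_of_compactSpace (by fun_prop) P).add hqi).const_mul _) h2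
    rw [integral_const_mul] at h4
    simp only [Pi.add_apply] at h4
    calc _ ≤ 2 * _ := mul_le_mul_of_nonneg_left h4 zero_le_two
      _ = _ := by ring
  · rw [integral_prod _ (hI' hEc)]
    have h5 := integral_inner_regRes_bias_sq_le (n := n) P (hφ.comp hπ) (fun z => hκ (π z)) hL h
    simp only [Function.comp_apply] at h5
    set I := ∫ w, ∫ z, E (w, z) ∂(Measure.pi fun _ : Fin n => P) ∂P
    have h6 : 4 * L * (n + 1) * I ≤ (1 + κ ^ 2 / L) ^ 2 * ‖h‖ ^ 2 := h5
    have hI0 : 0 ≤ I := integral_nonneg fun w => integral_nonneg fun z => sq_nonneg _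
    -- Weakening `n + 1` to `n` lets one factor `n` combine with `λ` into `L`.
    have h7 : 4 * L * n * I ≤ (1 + κ ^ 2 / L) ^ 2 * ‖h‖ ^ 2 := by nlinarith [mul_nonneg hL.le hI0]
    have h8 := mul_le_mul_of_nonneg_left h7 hlam.le
    have h9 : 4 * L ^ 2 * I = lam * (4 * L * n * I) := by rw [hLdef]; ring
    nlinarith [mul_nonneg (sq_nonneg L) hI0]

end Sample

/-! ### Hilbert-Schmidt norms and the effective dimension -/

section Hilbert

variable {K : Type*} [NormedAddCommGroup K] [InnerProductSpace ℝ K]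

/-- Orthonormal vectors are `√2` apart, so balls of radius `1/2` around them are disjoint.
Countability is what permits exchanging a basis expansion with an integral. -/
theorem countable_of_orthonormal [SeparableSpace K] {ι : Type*} {v : ι → K}
    (hv : Orthonormal ℝ v) : Countable ι := by
  have hdist : ∀ i j, i ≠ j → 1 < dist (v i) (v j) := fun i j hij => by
    have h1 : dist (v i) (v j) ^ 2 = 2 := by
      rw [dist_eq_norm, norm_sub_sq_real, hv.1 i, hv.1 j, hv.2 hij]
      norm_num
    nlinarith [dist_nonneg (x := v i) (y := v j)]
  have hd : Pairwise (Function.onFun Disjoint fun i => Metric.ball (v i) (1 / 2)) :=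
    fun i j hij => Metric.ball_disjoint_ball (by linarith [hdist i j hij])
  exact hd.countable_of_isOpen_disjoint (fun i => Metric.isOpen_ball)
    fun i => Metric.nonempty_ball.2 (by norm_num)

theorem _root_.HilbertBasis.enorm_sq_eq_tsum {ι : Type*} (b : HilbertBasis ι ℝ K) (x : K) :
    ‖x‖ₑ ^ 2 = ∑' i, ‖inner ℝ (b i) x‖ₑ ^ 2 := by
  have h : HasSum (fun i => inner ℝ (b i) x ^ 2) (‖x‖ ^ 2) := by
    have := b.hasSum_inner_mul_inner x x
    rw [real_inner_self_eq_norm_sq] at this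
    refine this.congr_fun ?_
    intro i
    rw [real_inner_comm, sq]
  rw [← ofReal_norm, ← ENNReal.ofReal_pow (norm_nonneg _), ← h.tsum_eq,
    ENNReal.ofReal_tsum_of_nonneg (fun i => sq_nonneg _) h.summable]
  refine tsum_congr fun i => ?_
  rw [← ofReal_norm, ← ENNReal.ofReal_pow (norm_nonneg _), Real.norm_eq_abs, sq_abs]

variable [CompleteSpace K] {H : Type*} [NormedAddCommGroup H] [InnerProductSpace ℝ H]
  [CompleteSpace H]

/-- The hypothesis gives `‖S a‖ = ‖A* a‖`, hence `A* a ↦ ⟨g, S a⟩` is a well-defined functional on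
the range of `A*` with norm at most `‖g‖`. Its Hahn-Banach extension is represented by `h`, and
testing against `A* f` gives `A h = S g`. -/
theorem exists_preimage_of_sqrt {S : K →L[ℝ] K} (hS : S.IsPositive) {A : H →L[ℝ] K}
    (hSA : S ∘L S = A ∘L A.adjoint) (g : K) : ∃ h : H, ‖h‖ ≤ ‖g‖ ∧ A h = S g := by
  have hsym : ∀ a b, inner ℝ (S a) b = inner ℝ a (S b) := fun a b => hS.isSymmetric a b
  have hnorm : ∀ a, ‖S a‖ = ‖A.adjoint a‖ := fun a => by
    have h1 : ‖S a‖ ^ 2 = ‖A.adjoint a‖ ^ 2 := by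
      rw [← real_inner_self_eq_norm_sq, ← real_inner_self_eq_norm_sq, hsym,
        ContinuousLinearMap.adjoint_inner_left]
      exact congrArg (fun T : K →L[ℝ] K => inner ℝ a (T a)) hSA
    exact (pow_left_inj₀ (norm_nonneg _) (norm_nonneg _) two_ne_zero).1 h1
  have heq : ∀ a b, A.adjoint a = A.adjoint b → S a = S b := fun a b hab => by
    rw [← sub_eq_zero, ← map_sub, ← norm_eq_zero, hnorm, map_sub, hab, sub_self, norm_zero]
  set p := LinearMap.range (A.adjoint : K →ₗ[ℝ] H) with hp
  -- The choice of preimages is immaterial: by `heq`, `S (pre x)` depends on `x` only.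
  choose pre hpre using fun x : p => LinearMap.mem_range.1 x.2
  have hpre' : ∀ x : p, A.adjoint (pre x) = x := hpre
  let F : p →ₗ[ℝ] ℝ :=
    { toFun := fun x => inner ℝ g (S (pre x))
      map_add' := fun x y => by
        rw [← inner_add_right, ← map_add]
        congr 1
        exact heq _ _ (by simp [map_add, hpre'])
      map_smul' := fun c x => by
        rw [RingHom.id_apply, smul_eq_mul, ← real_inner_smul_right, ← map_smul]
        congr 1
        exact heq _ _ (by simp [map_smul, hpre']) }
  let F' : p →L[ℝ] ℝ := F.mkContinuous ‖g‖ fun x => by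
    refine (norm_inner_le_norm (𝕜 := ℝ) g (S (pre x))).trans (le_of_eq ?_)
    rw [hnorm, hpre']
    rfl
  obtain ⟨G, hG, hGn⟩ := exists_extension_norm_eq p F'
  refine ⟨(InnerProductSpace.toDual ℝ H).symm G, ?_, ?_⟩
  · rw [LinearIsometryEquiv.norm_map, hGn]
    exact F.mkContinuous_norm_le (norm_nonneg _) _
  · refine ext_inner_right ℝ fun f => ?_
    rw [← ContinuousLinearMap.adjoint_inner_right, InnerProductSpace.toDual_symm_apply, hsym]
    have hmem : A.adjoint f ∈ p := ⟨f, rfl⟩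
    have h2 : G (A.adjoint f) = inner ℝ g (S (pre ⟨_, hmem⟩)) := hG ⟨_, hmem⟩
    rw [h2]
    congr 1
    exact heq _ _ (hpre' _)

end Hilbert

/-! ### Feature maps into `L²`, covariance operators and traces. -/

section Feature

variable {X : Type*} [TopologicalSpace X] [CompactSpace X] {H : Type*} [NormedAddCommGroup H]
  [InnerProductSpace ℝ H]

/-- The function `x ↦ ⟨φ x, u⟩`, linear in `u`. -/
def featureFun (φ : C(X, H)) : H →L[ℝ] C(X, ℝ) :=
  LinearMap.mkContinuous
    { toFun := fun u => ⟨fun x => inner ℝ (φ x) u, by fun_prop⟩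
      map_add' := fun u w => ContinuousMap.ext fun x => inner_add_right (φ x) u w
      map_smul' := fun c u => ContinuousMap.ext fun x => real_inner_smul_right (φ x) u c }
    ‖φ‖ fun u => by
      refine (ContinuousMap.norm_le _ (by positivity)).2 fun x => ?_
      exact (norm_inner_le_norm (𝕜 := ℝ) (φ x) u).trans
        (mul_le_mul_of_nonneg_right (φ.norm_coe_le_norm x) (norm_nonneg _))

theorem featureFun_apply (φ : C(X, H)) (u : H) (x : X) : featureFun φ u x = inner ℝ (φ x) u := rfl

variable [MeasurableSpace X] [BorelSpace X]

/-- The operator `u ↦ ⟨φ ·, u⟩` into `L²(μ)`. -/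
def featureLp (φ : C(X, H)) (μ : Measure X)
    [IsFiniteMeasure μ] : H →L[ℝ] Lp ℝ 2 μ :=
  (ContinuousMap.toLp 2 μ ℝ).comp (featureFun φ)

variable (φ : C(X, H)) (μ : Measure X) [IsFiniteMeasure μ]

theorem coeFn_featureLp (u : H) : featureLp φ μ u =ᵐ[μ] fun x => inner ℝ (φ x) u :=
  ContinuousMap.coeFn_toLp (p := 2) (𝕜 := ℝ) μ (featureFun φ u)

theorem inner_featureLp (u w : H) :
    inner ℝ (featureLp φ μ u) (featureLp φ μ w) = ∫ x, inner ℝ (φ x) u * inner ℝ (φ x) w ∂μ := by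
  rw [L2.inner_def]
  refine integral_congr_ae ?_
  filter_upwards [coeFn_featureLp φ μ u, coeFn_featureLp φ μ w] with x h1 h2
  rw [h1, h2]
  simp [mul_comm]

theorem norm_featureLp_sq (u : H) : ‖featureLp φ μ u‖ ^ 2 = ∫ x, inner ℝ (φ x) u ^ 2 ∂μ := by
  rw [← real_inner_self_eq_norm_sq, inner_featureLp]
  simp only [sq]

/-- The regularized covariance operator `Σ + lam`. -/
def covReg [CompleteSpace H] (lam : ℝ) : H →L[ℝ] H :=
  (featureLp φ μ).adjoint ∘L featureLp φ μ + lam • ContinuousLinearMap.id ℝ H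

theorem covReg_apply [CompleteSpace H] (lam : ℝ) (u : H) :
    covReg φ μ lam u = (featureLp φ μ).adjoint (featureLp φ μ u) + lam • u := rfl

variable [SecondCountableTopology X]

theorem enorm_featureLp_sq (u : H) :
    ‖featureLp φ μ u‖ₑ ^ 2 = ∫⁻ x, ‖inner ℝ (φ x) u‖ₑ ^ 2 ∂μ := by
  rw [← ofReal_norm, ← ENNReal.ofReal_pow (norm_nonneg _), norm_featureLp_sq,
    ofReal_integral_eq_lintegral_ofReal]
  · refine lintegral_congr fun x => ?_
    rw [← ofReal_norm, ← ENNReal.ofReal_pow (norm_nonneg _), Real.norm_eq_abs, sq_abs]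
  · exact Continuous.integrable_of_compactSpace (by fun_prop) μ
  · exact .of_forall fun x => sq_nonneg _

variable [CompleteSpace H]

theorem adjoint_featureLp_apply (u : H) :
    (featureLp φ μ).adjoint (featureLp φ μ u) = ∫ x, inner ℝ (φ x) u • φ x ∂μ := by
  refine ext_inner_right ℝ fun w => ?_
  rw [ContinuousLinearMap.adjoint_inner_left, inner_featureLp, real_inner_comm,
    ← integral_inner (Continuous.integrable_of_compactSpace (by fun_prop) μ)]
  refine integral_congr_ae (.of_forall fun x => ?_)
  simp only [real_inner_smul_right, real_inner_comm w]

/-- Both sides are the squared Hilbert-Schmidt norm of `T I*`, where `I` is `featureLp φ μ`: expand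
in a countable basis of `K`, move to the adjoint `I T*`, and expand in `b`. Working in `[0, ∞]`
removes all summability questions. -/
theorem lintegral_enorm_comp_feature_sq {K : Type*} [NormedAddCommGroup K] [InnerProductSpace ℝ K]
    [CompleteSpace K] [SeparableSpace K] (T : H →L[ℝ] K) {ι : Type*}
    (b : HilbertBasis ι ℝ (Lp ℝ 2 μ)) :
    ∫⁻ x, ‖T (φ x)‖ₑ ^ 2 ∂μ = ∑' i, ‖T ((featureLp φ μ).adjoint (b i))‖ₑ ^ 2 := by
  obtain ⟨w, e, -⟩ := exists_hilbertBasis ℝ K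
  have := countable_of_orthonormal e.orthonormal
  have hT : ∀ (j : w) (u : H), inner ℝ (e j) (T u) = inner ℝ u (T.adjoint (e j)) := fun j u => by
    rw [ContinuousLinearMap.adjoint_inner_right, real_inner_comm]
  calc ∫⁻ x, ‖T (φ x)‖ₑ ^ 2 ∂μ
      = ∫⁻ x, ∑' j, ‖inner ℝ (φ x) (T.adjoint (e j))‖ₑ ^ 2 ∂μ := by
        simp only [e.enorm_sq_eq_tsum, hT]
    _ = ∑' j, ‖featureLp φ μ (T.adjoint (e j))‖ₑ ^ 2 := by
        rw [lintegral_tsum]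
        · simp only [enorm_featureLp_sq]
        · exact fun j => Continuous.aemeasurable (by fun_prop)
    _ = ∑' j, ∑' i, ‖inner ℝ (e j) (T ((featureLp φ μ).adjoint (b i)))‖ₑ ^ 2 := by
        refine tsum_congr fun j => ?_
        rw [b.enorm_sq_eq_tsum]
        refine tsum_congr fun i => ?_
        rw [hT, ContinuousLinearMap.adjoint_inner_left]
    _ = ∑' i, ‖T ((featureLp φ μ).adjoint (b i))‖ₑ ^ 2 := by
        rw [ENNReal.tsum_comm]
        simp only [e.enorm_sq_eq_tsum]

theorem inner_covReg_self (lam : ℝ) (u : H) :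
    inner ℝ (covReg φ μ lam u) u = lam * ‖u‖ ^ 2 + ‖featureLp φ μ u‖ ^ 2 := by
  rw [covReg_apply, inner_add_left, ContinuousLinearMap.adjoint_inner_left,
    real_inner_smul_left, real_inner_self_eq_norm_sq, real_inner_self_eq_norm_sq, add_comm]

theorem isUnit_covReg {lam : ℝ} (hlam : 0 < lam) : IsUnit (covReg φ μ lam) := by
  refine isUnit_of_coercive _ hlam fun u => ?_
  rw [inner_covReg_self]
  nlinarith [sq_nonneg ‖featureLp φ μ u‖]

/-- Here `G = I I*` and `Σ = I* I`. With `W = (Σ + λ)⁻¹`, the integrand and the diagonal entries of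
`(G + λ)⁻¹ G` are the same quadratic form `λ‖W ·‖² + ‖I W ·‖²`, evaluated at `φ x` and at `I* bᵢ`.
The Hilbert-Schmidt identity for `T = W` and `T = I W` equates the totals. -/
theorem lintegral_eq_effectiveDimension [SeparableSpace H] {G : Lp ℝ 2 μ →L[ℝ] Lp ℝ 2 μ}
    (hG : G = featureLp φ μ ∘L (featureLp φ μ).adjoint) {lam : ℝ} (hlam : 0 < lam) :
    ∫⁻ x, ENNReal.ofReal (lam * ‖Ring.inverse (covReg φ μ lam) (φ x)‖ ^ 2 +
      ∫ x', inner ℝ (φ x') (Ring.inverse (covReg φ μ lam) (φ x)) ^ 2 ∂μ) ∂μ =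
      effectiveDimension G lam := by
  set I := featureLp φ μ with hI
  set W := Ring.inverse (covReg φ μ lam) with hW
  have hV := isUnit_covReg φ μ hlam
  have hG' : ∀ f, G f = I (I.adjoint f) := fun f => by rw [hG]; rfl
  have hGu : IsUnit (G + lam • ContinuousLinearMap.id ℝ (Lp ℝ 2 μ)) := by
    refine isUnit_of_coercive _ hlam fun f => ?_
    have : (G + lam • ContinuousLinearMap.id ℝ (Lp ℝ 2 μ)) f = G f + lam • f := rfl
    rw [this, inner_add_left, real_inner_smul_left, real_inner_self_eq_norm_sq, hG',
      ← ContinuousLinearMap.adjoint_inner_right, real_inner_self_eq_norm_sq]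
    nlinarith [sq_nonneg ‖I.adjoint f‖]
  set b := (exists_hilbertBasis ℝ (Lp ℝ 2 μ)).choose_spec.choose with hb
  have hsplit : ∀ (u : H) , ENNReal.ofReal (lam * ‖u‖ ^ 2 + ‖I u‖ ^ 2) =
      ENNReal.ofReal lam * ‖u‖ₑ ^ 2 + ‖I u‖ₑ ^ 2 := fun u => by
    rw [ENNReal.ofReal_add (by positivity) (by positivity), ENNReal.ofReal_mul hlam.le,
      ENNReal.ofReal_pow (norm_nonneg _), ENNReal.ofReal_pow (norm_nonneg _),
      ofReal_norm, ofReal_norm]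
  have hterm : ∀ f : Lp ℝ 2 μ,
      inner ℝ ((Ring.inverse (G + lam • ContinuousLinearMap.id ℝ (Lp ℝ 2 μ)) ∘L G) f) f =
        lam * ‖W (I.adjoint f)‖ ^ 2 + ‖I (W (I.adjoint f))‖ ^ 2 := fun f => by
    set R := Ring.inverse (G + lam • ContinuousLinearMap.id ℝ (Lp ℝ 2 μ)) with hR
    have hGs : ∀ a c, inner ℝ (G a) c = inner ℝ a (G c) := fun a c => by
      rw [hG', hG', ← ContinuousLinearMap.adjoint_inner_right,
        ContinuousLinearMap.adjoint_inner_left]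
    have hRs : ∀ a c, inner ℝ (R a) c = inner ℝ a (R c) := by
      refine inner_inverse_comm hGu fun a c => ?_
      change inner ℝ (G a + lam • a) c = inner ℝ a (G c + lam • c)
      rw [inner_add_left, inner_add_right, hGs, real_inner_smul_left, real_inner_smul_right]
    -- Push-through identity `I* (I I* + λ)⁻¹ = (I* I + λ)⁻¹ I*`.
    have hw : I.adjoint (R f) = W (I.adjoint f) := by
      have h1 : covReg φ μ lam (I.adjoint (R f)) = I.adjoint f := by
        have h2 : G (R f) + lam • R f = f := self_apply_inverse hGu f
        rw [covReg_apply, ← hI, ← hG', ← map_smul, ← map_add, h2]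
      rw [← h1, hW, inverse_apply_self hV]
    have h3 : inner ℝ (R (G f)) f = inner ℝ (I.adjoint f) (I.adjoint (R f)) := by
      rw [hRs, hG', ← ContinuousLinearMap.adjoint_inner_right]
    rw [ContinuousLinearMap.comp_apply, h3, hw, ← inner_covReg_self, hW, self_apply_inverse hV]
  have hl : ∀ x, ENNReal.ofReal (lam * ‖W (φ x)‖ ^ 2 + ∫ x', inner ℝ (φ x') (W (φ x)) ^ 2 ∂μ) =
      ENNReal.ofReal lam * ‖W (φ x)‖ₑ ^ 2 + ‖(I ∘L W) (φ x)‖ₑ ^ 2 := fun x => by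
    rw [← norm_featureLp_sq, hsplit]
    rfl
  have hL2 : SeparableSpace (Lp ℝ 2 μ) :=
    have : Fact ((2 : ℝ≥0∞) ≠ ∞) := ⟨by simp⟩
    inferInstance
  simp only [hl]
  rw [lintegral_add_left ((Continuous.measurable (by fun_prop)).const_mul _), lintegral_const_mul _
    (Continuous.measurable (by fun_prop)), lintegral_enorm_comp_feature_sq φ μ W b,
    lintegral_enorm_comp_feature_sq φ μ (I ∘L W) b, ← ENNReal.tsum_mul_left, ← ENNReal.tsum_add]
  unfold effectiveDimension positiveTrace
  refine tsum_congr fun i => ?_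
  rw [hterm, hsplit]
  rfl

end Feature

/-! ### The feature map of a kernel and the ridge estimator -/

section FeatureMap

variable {X : Type*} [TopologicalSpace X] (k : ContKernel X)

theorem inner_kerFun_one (x : X) (f : k.Space) :
    inner ℝ (RKHS.kerFun k.Space x (1 : ℝ)) f = f x := by
  rw [RKHS.kerFun_inner]
  simp

theorem inner_kerFun_kerFun (x y : X) :
    inner ℝ (RKHS.kerFun k.Space x (1 : ℝ)) (RKHS.kerFun k.Space y (1 : ℝ)) = k.toMap (x, y) := by
  rw [inner_kerFun_one, RKHS.kerFun_apply, RKHS.OfKernel.kernel_ofKernel]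
  simp [ContKernel.opMatrix]

theorem continuous_kerFun_one : Continuous fun x => RKHS.kerFun k.Space x (1 : ℝ) := by
  refine continuous_iff_continuousAt.2 fun x => ?_
  rw [ContinuousAt, tendsto_iff_norm_sub_tendsto_zero]
  have h : ∀ y, ‖RKHS.kerFun k.Space y (1 : ℝ) - RKHS.kerFun k.Space x (1 : ℝ)‖ =
      √(k.toMap (y, y) - 2 * k.toMap (y, x) + k.toMap (x, x)) := fun y => by
    rw [← Real.sqrt_sq (norm_nonneg _), norm_sub_sq_real, ← real_inner_self_eq_norm_sq,
      ← real_inner_self_eq_norm_sq, inner_kerFun_kerFun, inner_kerFun_kerFun, inner_kerFun_kerFun]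
  simp only [h]
  have hc : Continuous fun y => √(k.toMap (y, y) - 2 * k.toMap (y, x) + k.toMap (x, x)) := by
    fun_prop
  have := hc.tendsto x
  convert this using 2
  rw [show k.toMap (x, x) - 2 * k.toMap (x, x) + k.toMap (x, x) = 0 by ring, Real.sqrt_zero]

/-- The feature map `x ↦ k(·, x)` into the reproducing kernel Hilbert space. -/
def ContKernel.feature : C(X, k.Space) :=
  ⟨fun x => RKHS.kerFun k.Space x (1 : ℝ), continuous_kerFun_one k⟩

theorem ContKernel.inner_feature (x : X) (f : k.Space) : inner ℝ (k.feature x) f = f x :=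
  inner_kerFun_one k x f

theorem ContKernel.inner_feature_feature (x y : X) :
    inner ℝ (k.feature x) (k.feature y) = k.toMap (x, y) :=
  inner_kerFun_kerFun k x y

theorem ContKernel.norm_feature_le {κ : ℝ} (hκ : 0 ≤ κ) {x : X} (h : |k.toMap (x, x)| ≤ κ ^ 2) :
    ‖k.feature x‖ ≤ κ := by
  refine le_of_sq_le_sq ?_ hκ
  rw [← real_inner_self_eq_norm_sq, k.inner_feature_feature]
  exact (le_abs_self _).trans h

/-- The features are the continuous image of a separable space and span a dense subspace. This
supplies the countable orthonormal basis used in the trace computation. -/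
theorem ContKernel.separableSpace [SeparableSpace X] : SeparableSpace k.Space := by
  have h1 : IsSeparable (Submodule.span ℝ (Set.range k.feature) : Set k.Space) :=
    (isSeparable_range k.feature.continuous).span
  have h2 : Submodule.span ℝ {RKHS.kerFun k.Space x v | (x) (v)} ≤
      Submodule.span ℝ (Set.range k.feature) := by
    refine Submodule.span_le.2 ?_
    rintro _ ⟨x, v, rfl⟩
    have : RKHS.kerFun k.Space x v = v • k.feature x := by
      rw [ContKernel.feature, ContinuousMap.coe_mk, ← map_smul, smul_eq_mul, mul_one]
    rw [this]
    exact Submodule.smul_mem _ _ (Submodule.subset_span ⟨x, rfl⟩)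
  have h3 := Submodule.topologicalClosure_mono h2
  rw [RKHS.kerFun_dense, top_le_iff] at h3
  have h4 := h1.closure
  rw [← Submodule.topologicalClosure_coe, h3, Submodule.top_coe] at h4
  exact isSeparable_univ_iff.1 h4

/-- The objective is quadratic and `f₀` solves its normal equations, so the linear term at `f₀`
vanishes. The penalty becomes `nλ` because the equations are multiplied by `n`. -/
theorem ridgeObjective_eq_add {lam : ℝ} (hlam : 0 < lam) {n : ℕ} (hn : 0 < n)
    (z : Fin n → X × ℝ) (f : k.Space) :
    letI f₀ := regRes (n * lam) (fun j => k.feature (z j).1) (∑ j, (z j).2 • k.feature (z j).1)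
    ridgeObjective k lam z f = ridgeObjective k lam z f₀ +
      ((1 / (n : ℝ)) * ∑ j, inner ℝ (k.feature (z j).1) (f - f₀) ^ 2 + lam * ‖f - f₀‖ ^ 2) := by
  set f₀ := regRes (n * lam) (fun j => k.feature (z j).1) (∑ j, (z j).2 • k.feature (z j).1)
  have hn' : (0 : ℝ) < n := by exact_mod_cast hn
  have h0 : regCov (n * lam) (fun j => k.feature (z j).1) f₀ = ∑ j, (z j).2 • k.feature (z j).1 :=
    regCov_regRes (mul_pos hn' hlam) _ _
  obtain ⟨d, rfl⟩ : ∃ d, f = f₀ + d := ⟨f - f₀, by abel⟩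
  have h1 := congrArg (fun u => inner ℝ u d) h0
  simp only [inner_regCov, sum_inner, real_inner_smul_left] at h1
  have h2 : ∀ j, ((f₀ + d) (z j).1 - (z j).2) ^ 2 = (f₀ (z j).1 - (z j).2) ^ 2 +
      inner ℝ (k.feature (z j).1) d ^ 2 + 2 * (inner ℝ (k.feature (z j).1) f₀ *
        inner ℝ (k.feature (z j).1) d - (z j).2 * inner ℝ (k.feature (z j).1) d) := fun j => by
    rw [← k.inner_feature, ← k.inner_feature, inner_add_right]
    ring
  rw [add_sub_cancel_left]
  simp only [ridgeObjective, h2, Finset.sum_add_distrib, ← Finset.mul_sum, Finset.sum_sub_distrib,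
    norm_add_sq_real]
  rw [← h1]
  field_simp
  ring

theorem ridgeEstimator_eq {lam : ℝ} (hlam : 0 < lam) {n : ℕ} (hn : 0 < n) (z : Fin n → X × ℝ) :
    ridgeEstimator k lam z =
      regRes (n * lam) (fun j => k.feature (z j).1) (∑ j, (z j).2 • k.feature (z j).1) := by
  set f₀ := regRes (n * lam) (fun j => k.feature (z j).1) (∑ j, (z j).2 • k.feature (z j).1)
  have hge : ∀ f, ridgeObjective k lam z f₀ + lam * ‖f - f₀‖ ^ 2 ≤ ridgeObjective k lam z f :=
    fun f => by
      have := ridgeObjective_eq_add k hlam hn z f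
      rw [this]
      have h : 0 ≤ (1 / (n : ℝ)) * ∑ j, inner ℝ (k.feature (z j).1) (f - f₀) ^ 2 := by positivity
      linarith
  have hex : ∃ f, IsMinOn (ridgeObjective k lam z) Set.univ f := ⟨f₀, fun f _ => by
    have := hge f
    have h : 0 ≤ lam * ‖f - f₀‖ ^ 2 := by positivity
    change ridgeObjective k lam z f₀ ≤ ridgeObjective k lam z f
    linarith⟩
  have hmin : IsMinOn (ridgeObjective k lam z) Set.univ (ridgeEstimator k lam z) :=
    Classical.epsilon_spec hex
  have h1 : ridgeObjective k lam z (ridgeEstimator k lam z) ≤ ridgeObjective k lam z f₀ :=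
    hmin (Set.mem_univ f₀)
  have h2 := hge (ridgeEstimator k lam z)
  have h3 : ‖ridgeEstimator k lam z - f₀‖ ^ 2 ≤ 0 := by
    have : lam * ‖ridgeEstimator k lam z - f₀‖ ^ 2 ≤ 0 := by linarith
    exact nonpos_of_mul_nonpos_right this hlam
  have h4 : ‖ridgeEstimator k lam z - f₀‖ = 0 := by
    have := sq_nonneg ‖ridgeEstimator k lam z - f₀‖
    exact pow_eq_zero_iff two_ne_zero |>.1 (le_antisymm h3 this)
  exact sub_eq_zero.1 (norm_eq_zero.1 h4)

/-- Apply the resolvent to `(L + ∑ φ(x_j) ⊗ φ(x_j)) h = L h + ∑ h(x_j) φ(x_j)` and subtract from the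
formula for the estimator. -/
theorem ridgeEstimator_sub {lam : ℝ} (hlam : 0 < lam) {n : ℕ} (hn : 0 < n) (z : Fin n → X × ℝ)
    (h : k.Space) :
    ridgeEstimator k lam z - h =
      regRes (n * lam) (fun j => k.feature (z j).1)
        (∑ j, ((z j).2 - h (z j).1) • k.feature (z j).1) -
      (n * lam) • regRes (n * lam) (fun j => k.feature (z j).1) h := by
  have hn' : (0 : ℝ) < n := by exact_mod_cast hn
  have h1 := regCov_apply (n * lam) (fun j => k.feature (z j).1) h
  have h2 := congrArg (regRes (n * lam) (fun j => k.feature (z j).1)) h1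
  rw [regRes_regCov (mul_pos hn' hlam), map_add, map_smul] at h2
  rw [ridgeEstimator_eq k hlam hn]
  simp only [sub_smul, Finset.sum_sub_distrib, map_sub]
  simp only [k.inner_feature] at h2
  conv_lhs => rw [h2]
  abel

end FeatureMap

/-! ### Integral operators, and regression functions in the kernel space. -/

section Integral

variable {X : Type*} [TopologicalSpace X] [CompactSpace X] [MeasurableSpace X] [BorelSpace X]

theorem ContKernel.integralOp_eq [SecondCountableTopologyEither X ℝ] (k : ContKernel X) (μ : Measure X) [IsFiniteMeasure μ] :
    k.integralOp μ = featureLp k.feature μ ∘L (featureLp k.feature μ).adjoint := by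
  ext1 f
  change ContinuousMap.toLp 2 μ ℝ (k.integralFun μ f) = ContinuousMap.toLp 2 μ ℝ
    (featureFun k.feature ((featureLp k.feature μ).adjoint f))
  congr 1
  ext x
  change inner ℝ (k.sectionLp μ x) f = inner ℝ (k.feature x) ((featureLp k.feature μ).adjoint f)
  rw [ContinuousLinearMap.adjoint_inner_right]
  congr 1
  change ContinuousMap.toLp 2 μ ℝ (k.toMap.curry x) =
    ContinuousMap.toLp 2 μ ℝ (featureFun k.feature (k.feature x))
  congr 1
  ext y
  rw [featureFun_apply, real_inner_comm, k.inner_feature_feature]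
  rfl

variable [SecondCountableTopology X]

/-- A regression function satisfying the source condition has a representative in the
reproducing kernel Hilbert space. -/
theorem SourceCondition.exists_mem_space {Y : Set ℝ} {k : ContKernel X} {P : Measure (X × Y)}
    [IsFiniteMeasure P] {c₁ : ℝ} (h : SourceCondition k P c₁) :
    ∃ f : k.Space, ‖f‖ ≤ c₁ ∧ regressionFunction P =ᵐ[P.fst] f := by
  obtain ⟨S, ⟨hS, hSS⟩, g, hg, hfg⟩ := h
  rw [k.integralOp_eq] at hSS
  obtain ⟨f, hf, hfS⟩ := exists_preimage_of_sqrt hS hSS g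
  refine ⟨f, hf.trans hg, hfg.trans ?_⟩
  rw [← hfS]
  filter_upwards [coeFn_featureLp k.feature P.fst f] with x hx
  rw [hx, k.inner_feature]

/-- `h` is a version of the conditional expectation of `y` given `x`; pulling `g` out of the
conditional expectation and integrating gives the orthogonality. -/
theorem integral_residual_mul_eq_zero {Y : Set ℝ} [CompactSpace Y] {P : Measure (X × Y)}
    [IsProbabilityMeasure P] {h : X → ℝ} (hc : Continuous h)
    (hreg : regressionFunction P =ᵐ[P.fst] h) {g : X → ℝ} (hg : Continuous g) :
    ∫ z, ((z.2 : ℝ) - h z.1) * g z.1 ∂P = 0 := by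
  have hi : ∀ {f : X × Y → ℝ}, Continuous f → Integrable f P :=
    fun hf => hf.integrable_of_compactSpace P
  set m : MeasurableSpace (X × Y) := MeasurableSpace.comap Prod.fst inferInstance with hm
  have hmle : m ≤ Prod.instMeasurableSpace := measurable_fst.comap_le
  have hcond := condExp_ae_eq_integral_condDistrib' (μ := P) (Y := fun z : X × Y => (z.2 : ℝ))
    (measurable_fst (α := X) (β := Y)) (hi (by fun_prop))
  have hreg' : ∀ᵐ z ∂P, regressionFunction P z.1 = h z.1 :=
    ae_of_ae_map measurable_fst.aemeasurable hreg
  have hgm : StronglyMeasurable[m] fun z : X × Y => g z.1 :=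
    (hg.measurable.comp (comap_measurable Prod.fst)).stronglyMeasurable
  have hpull := condExp_mul_of_stronglyMeasurable_right (μ := P) hgm
    (f := fun z : X × Y => (z.2 : ℝ)) (hi (f := (fun z : X × Y => (z.2 : ℝ)) * fun z => g z.1)
      (by fun_prop)) (hi (by fun_prop))
  have h1 : ∫ z, (z.2 : ℝ) * g z.1 ∂P = ∫ z, h z.1 * g z.1 ∂P := by
    have h2 := integral_condExp (μ := P) hmle (f := (fun z : X × Y => (z.2 : ℝ)) * fun z => g z.1)
    refine h2.symm.trans (integral_congr_ae ?_)
    filter_upwards [hpull, hcond, hreg'] with z hz1 hz2 hz3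
    rw [hz1, Pi.mul_apply, hz2, ← hz3]
    rfl
  simp only [sub_mul]
  rw [integral_sub (hi (by fun_prop)) (hi (by fun_prop)), h1, sub_self]

end Integral

/-! ### The rate of convergence -/

theorem three_le_gamma_add_log : 3 ≤ 6 * Real.Gamma 9 + Real.log (6 ^ 8) := by
  have h1 : Real.Gamma 9 = 40320 := by
    have := Real.Gamma_nat_eq_factorial 8
    rw [show ((8 : ℕ) : ℝ) + 1 = 9 by norm_num] at this
    rw [this]
    norm_num [Nat.factorial]
  have h2 : 0 ≤ Real.log (6 ^ 8) := Real.log_nonneg (by norm_num)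
  linarith

theorem ridgeConstant_pos {κ M c₁ c₂ : ℝ} (hκ : 0 < κ) (hM : 0 ≤ M) (hc₁ : 0 < c₁) :
    0 < ridgeConstant κ M c₁ c₂ := by
  have := three_le_gamma_add_log
  have h2 : 0 < 6 * Real.Gamma 9 + Real.log (6 ^ 8) := by linarith
  unfold ridgeConstant
  positivity

/-- Each of the three copies (two from the noise, one from the bias) is at most `Q`, the constant
without its leading factor, and that factor is at least `3`. -/
theorem le_ridgeConstant {κ M c₁ c₂ : ℝ} (hκ : 0 < κ) (hM : 0 ≤ M) (hc₁ : 0 < c₁)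
    (hc₂ : 0 < c₂) :
    2 * (M + κ * c₁) ^ 2 * (1 + κ ^ 2) * c₂ + (1 + κ ^ 2) ^ 2 * c₁ ^ 2 ≤
      ridgeConstant κ M c₁ c₂ := by
  suffices hkey : ∀ A : ℝ, 3 ≤ A → 2 * (M + κ * c₁) ^ 2 * (1 + κ ^ 2) * c₂ +
      (1 + κ ^ 2) ^ 2 * c₁ ^ 2 ≤ A * (8 * M / κ + 6 * c₁) ^ 2 *
        (4 * (κ ^ 2 + κ * √c₂) ^ 2 + 1) ^ 2 * (2 * κ ^ 2 + 2 * κ * √c₂ + 1) ^ 4 from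
    hkey _ three_le_gamma_add_log
  intro A hA
  set r := √c₂
  have hr : 0 < r := Real.sqrt_pos.2 hc₂
  have hr2 : c₂ = r ^ 2 := (Real.sq_sqrt hc₂.le).symm
  set D := 8 * M / κ + 6 * c₁ with hD
  set s := κ ^ 2 + κ * r with hs
  have hMκ : 0 ≤ M / κ := by positivity
  have hD1 : c₁ ≤ D := by
    have : D = 8 * (M / κ) + 6 * c₁ := by rw [hD]; ring
    linarith
  have hD2 : M + κ * c₁ ≤ κ * D := by
    have : κ * D = 8 * M + 6 * (κ * c₁) := by rw [hD]; field_simp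
    have := mul_pos hκ hc₁
    linarith
  have hF : 2 * κ ^ 2 + 2 * κ * r + 1 = 2 * s + 1 := by rw [hs]; ring
  rw [hF]
  have hκs : κ ^ 2 ≤ s := le_add_of_nonneg_right (mul_pos hκ hr).le
  have hrs : κ * r ≤ s := le_add_of_nonneg_left (sq_nonneg κ)
  have hs0 : 0 < s := (mul_pos hκ hr).trans_le hrs
  -- The division by `κ` in `D` is compensated by pairing `κ` with `√c₂`, since `κ √c₂ ≤ s`.
  have h1 : (M + κ * c₁) ^ 2 * c₂ ≤ D ^ 2 * s ^ 2 := by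
    calc (M + κ * c₁) ^ 2 * c₂ ≤ (κ * D) ^ 2 * r ^ 2 := by
          rw [hr2]
          gcongr
      _ = D ^ 2 * (κ * r) ^ 2 := by ring
      _ ≤ _ := by gcongr
  have hs2 : 0 ≤ s ^ 2 := sq_nonneg s
  have h2' : 1 ≤ (4 * s ^ 2 + 1) ^ 2 := one_le_pow₀ (by linarith)
  have h2 : s ^ 2 ≤ (4 * s ^ 2 + 1) ^ 2 :=
    (by linarith : s ^ 2 ≤ 4 * s ^ 2 + 1).trans (le_self_pow₀ (by linarith) two_ne_zero)
  have h3 : 1 + κ ^ 2 ≤ (2 * s + 1) ^ 4 :=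
    (by linarith : 1 + κ ^ 2 ≤ 2 * s + 1).trans (le_self_pow₀ (by linarith) (by norm_num))
  have h3' : (1 + κ ^ 2) ^ 2 ≤ (2 * s + 1) ^ 4 :=
    (pow_le_pow_left₀ (by positivity) (by linarith : 1 + κ ^ 2 ≤ 2 * s + 1) 2).trans
      (pow_le_pow_right₀ (by linarith) (by norm_num))
  set Q := D ^ 2 * (4 * s ^ 2 + 1) ^ 2 * (2 * s + 1) ^ 4 with hQ
  have hQ0 : 0 ≤ Q := by positivity
  have h4 : (M + κ * c₁) ^ 2 * c₂ * (1 + κ ^ 2) ≤ Q := by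
    rw [hQ]
    refine mul_le_mul (h1.trans ?_) h3 (by positivity) (by positivity)
    exact mul_le_mul_of_nonneg_left h2 (sq_nonneg _)
  have h5 : (1 + κ ^ 2) ^ 2 * c₁ ^ 2 ≤ Q := by
    calc (1 + κ ^ 2) ^ 2 * c₁ ^ 2 ≤ (2 * s + 1) ^ 4 * D ^ 2 := by gcongr
      _ = D ^ 2 * 1 * (2 * s + 1) ^ 4 := by ring
      _ ≤ Q := by rw [hQ]; gcongr
  have h6 : A * D ^ 2 * (4 * s ^ 2 + 1) ^ 2 * (2 * s + 1) ^ 4 = A * Q := by rw [hQ]; ring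
  rw [h6]
  calc 2 * (M + κ * c₁) ^ 2 * (1 + κ ^ 2) * c₂ + (1 + κ ^ 2) ^ 2 * c₁ ^ 2
      = 2 * ((M + κ * c₁) ^ 2 * c₂ * (1 + κ ^ 2)) + (1 + κ ^ 2) ^ 2 * c₁ ^ 2 := by ring
    _ ≤ 2 * Q + Q := by gcongr
    _ = 3 * Q := by ring
    _ ≤ A * Q := mul_le_mul_of_nonneg_right hA hQ0

theorem one_le_mul_rpow {n : ℕ} (hn : 0 < n) {c : ℝ} (hc : 0 < c) :
    1 ≤ n * (n : ℝ) ^ (-(1 / (c + 1))) := by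
  have hn' : (1 : ℝ) ≤ n := by exact_mod_cast hn
  have hn0 : (0 : ℝ) < n := by linarith
  rw [← Real.rpow_one_add' hn0.le]
  · refine Real.one_le_rpow hn' ?_
    have : 1 / (c + 1) ≤ 1 := (div_le_one (by linarith)).2 (by linarith)
    linarith
  · have : 1 / (c + 1) < 1 := (div_lt_one (by linarith)).2 (by linarith)
    linarith

/-- The balance that dictates the choice of `λ`: the variance order `λ^{-c₃}/n` equals the bias
order `λ`. -/
theorem rpow_rpow_div {n : ℕ} (hn : 0 < n) {c : ℝ} (hc : 0 < c) :
    ((n : ℝ) ^ (-(1 / (c + 1)))) ^ (-c) / n = (n : ℝ) ^ (-(1 / (c + 1))) := by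
  have hn0 : (0 : ℝ) < n := by exact_mod_cast hn
  rw [← Real.rpow_mul hn0.le, ← Real.rpow_sub_one hn0.ne']
  congr 1
  field_simp
  ring

/-! ### From the Hilbert space estimate to the error in `L²`. -/

section Rate

variable {X : Type*} [TopologicalSpace X] [MeasurableSpace X] [BorelSpace X]
  [SecondCountableTopology X]

theorem _root_.MeasureTheory.Measure.integral_fst_of_continuous {Z E : Type*} [MeasurableSpace Z]
    [NormedAddCommGroup E] [NormedSpace ℝ E] (P : Measure (X × Z)) {f : X → E}
    (hf : Continuous f) : ∫ x, f x ∂P.fst = ∫ z, f z.1 ∂P :=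
  integral_map measurable_fst.aemeasurable hf.aestronglyMeasurable

variable [CompactSpace X]

theorem eLpNorm_sub_regressionFunction_sq {Y : Set ℝ} {k : ContKernel X} {P : Measure (X × Y)}
    [IsFiniteMeasure P] {h : k.Space} (hreg : regressionFunction P =ᵐ[P.fst] h) (f : k.Space) :
    MemLp (fun x => f x - regressionFunction P x) 2 P.fst ∧
      eLpNorm (fun x => f x - regressionFunction P x) 2 P.fst ^ 2 =
        ENNReal.ofReal (∫ z, inner ℝ (k.feature z.1) (f - h) ^ 2 ∂P) := by
  have hae : (fun x => f x - regressionFunction P x) =ᵐ[P.fst]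
      featureLp k.feature P.fst (f - h) := by
    filter_upwards [hreg, coeFn_featureLp k.feature P.fst (f - h)] with x h1 h2
    rw [h1, h2, inner_sub_right, k.inner_feature, k.inner_feature]
  refine ⟨(memLp_congr_ae hae).2 (Lp.memLp _), ?_⟩
  rw [eLpNorm_congr_ae hae, ← Lp.enorm_def, ← ofReal_norm, ← ENNReal.ofReal_pow (norm_nonneg _),
    norm_featureLp_sq, Measure.integral_fst_of_continuous P (by fun_prop)]

theorem integral_le_of_effectiveDimension_le {Z : Type*} [MeasurableSpace Z]
    {P : Measure (X × Z)} [IsProbabilityMeasure P] {H : Type*} [NormedAddCommGroup H]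
    [InnerProductSpace ℝ H] [CompleteSpace H] [SeparableSpace H] (φ : C(X, H))
    {G : Lp ℝ 2 P.fst →L[ℝ] Lp ℝ 2 P.fst}
    (hG : G = featureLp φ P.fst ∘L (featureLp φ P.fst).adjoint) {N lam : ℝ}
    (hlam : 0 < lam) (hN : 0 ≤ N) (hdim : effectiveDimension G lam ≤ ENNReal.ofReal N) :
    ∫ w, (lam * ‖Ring.inverse (covReg φ P.fst lam) (φ w.1)‖ ^ 2 +
      ∫ w', inner ℝ (φ w'.1) (Ring.inverse (covReg φ P.fst lam) (φ w.1)) ^ 2 ∂P) ∂P ≤ N := by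
  set W := Ring.inverse (covReg φ P.fst lam)
  have h1 := lintegral_eq_effectiveDimension φ P.fst hG hlam
  have h2 : ∀ x, ∫ x', inner ℝ (φ x') (W (φ x)) ^ 2 ∂P.fst =
      ∫ w', inner ℝ (φ w'.1) (W (φ x)) ^ 2 ∂P := fun x =>
    Measure.integral_fst_of_continuous P (by fun_prop)
  have h3 : Integrable (fun x => lam * ‖W (φ x)‖ ^ 2 +
      ∫ x', inner ℝ (φ x') (W (φ x)) ^ 2 ∂P.fst) P.fst := by
    refine (Continuous.integrable_of_compactSpace (by fun_prop) _).add ?_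
    exact Integrable.integral_prod_left
      (f := fun p : X × X => inner ℝ (φ p.2) (W (φ p.1)) ^ 2)
      (Continuous.integrable_of_compactSpace (by fun_prop) (P.fst.prod P.fst))
  have h4 : ∫ w, (lam * ‖W (φ w.1)‖ ^ 2 +
      ∫ w', inner ℝ (φ w'.1) (W (φ w.1)) ^ 2 ∂P) ∂P =
      ∫ x, (lam * ‖W (φ x)‖ ^ 2 +
      ∫ x', inner ℝ (φ x') (W (φ x)) ^ 2 ∂P.fst) ∂P.fst := by
    simp only [← h2]
    exact (integral_map measurable_fst.aemeasurable h3.aestronglyMeasurable).symm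
  rw [h4, ← ENNReal.ofReal_le_ofReal_iff hN, ofReal_integral_eq_lintegral_ofReal h3
    (.of_forall fun x => add_nonneg (by positivity) (integral_nonneg fun _ => sq_nonneg _)), h1]
  exact hdim

theorem lintegral_eLpNorm_ridgeEstimator_sub_le {Y : Set ℝ} [CompactSpace Y] {k : ContKernel X}
    {P : Measure (X × Y)} [IsProbabilityMeasure P] {κ M c₁ N lam : ℝ} (hκ : 0 < κ)
    (hk : ∀ x, |k.toMap (x, x)| ≤ κ ^ 2) (hM : ∀ y : Y, |(y : ℝ)| ≤ M)
    (hP : SourceCondition k P c₁) (hlam : 0 < lam) (hN : 0 ≤ N)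
    (hdim : effectiveDimension (k.integralOp P.fst) lam ≤ ENNReal.ofReal N) {n : ℕ} (hn : 0 < n)
    {ν : Measure X} {c : ℝ} (hc : 0 ≤ c)
    (hnorm : ∀ f : X → ℝ, MemLp f 2 P.fst →
      eLpNorm f 2 ν ≤ ENNReal.ofReal c * eLpNorm f 2 P.fst) :
    ∫⁻ z : Fin n → X × Y, eLpNorm (fun x => ridgeEstimator k lam
        (fun j => ((z j).1, ((z j).2 : ℝ))) x - regressionFunction P x) 2 ν ^ 2
        ∂(Measure.pi fun _ : Fin n => P) ≤
      ENNReal.ofReal (c ^ 2 * (2 * (M + κ * c₁) ^ 2 * (1 + κ ^ 2 / (n * lam)) / n * N +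
        (1 + κ ^ 2 / (n * lam)) ^ 2 * lam * c₁ ^ 2)) := by
  have hn' : (0 : ℝ) < n := by exact_mod_cast hn
  have hsep := k.separableSpace
  obtain ⟨h, hh, hreg⟩ := hP.exists_mem_space
  have hφ : ∀ x, ‖k.feature x‖ ≤ κ := fun x => k.norm_feature_le hκ.le (hk x)
  have hhc : Continuous h := by
    have : (h : X → ℝ) = fun x => inner ℝ (k.feature x) h :=
      funext fun x => (k.inner_feature x h).symm
    rw [this]
    fun_prop
  set ε : X × Y → ℝ := fun z => (z.2 : ℝ) - h z.1 with hε
  have hεc : Continuous ε := by fun_prop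
  -- The sup norm of `h` is at most `κ‖h‖` by the reproducing property.
  have hB : ∀ z, |ε z| ≤ M + κ * c₁ := fun z => by
    have h1 : |h z.1| ≤ κ * c₁ := by
      rw [← k.inner_feature]
      exact (abs_real_inner_le_norm _ _).trans
        (mul_le_mul (hφ _) hh (norm_nonneg _) hκ.le)
    exact (abs_sub _ _).trans (add_le_add (hM z.2) h1)
  set W := Ring.inverse (covReg k.feature P.fst lam) with hW
  have hu : ∀ x, k.feature x = (∫ w, inner ℝ (k.feature w.1) (W (k.feature x)) • k.feature w.1 ∂P) +
      lam • W (k.feature x) := fun x => by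
    have h1 := self_apply_inverse (isUnit_covReg k.feature P.fst hlam) (k.feature x)
    rw [covReg_apply, adjoint_featureLp_apply,
      Measure.integral_fst_of_continuous P (by fun_prop)] at h1
    exact h1.symm
  have hmain := integral_sq_error_le P k.feature.continuous hφ continuous_fst hεc hB
    (fun g hg => integral_residual_mul_eq_zero hhc hreg hg) hn hlam h
    (u := fun x => W (k.feature x)) (by fun_prop) hu
  have hNle := integral_le_of_effectiveDimension_le k.feature (k.integralOp_eq P.fst) hlam hN hdim
  have hbound : ∀ z : Fin n → X × Y, eLpNorm (fun x => ridgeEstimator k lam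
        (fun j => ((z j).1, ((z j).2 : ℝ))) x - regressionFunction P x) 2 ν ^ 2 ≤
      ENNReal.ofReal (c ^ 2 * ∫ w, inner ℝ (k.feature w.1) (regRes (n * lam)
        (fun j => k.feature (z j).1) (∑ j, ε (z j) • k.feature (z j).1) -
        (n * lam) • regRes (n * lam) (fun j => k.feature (z j).1) h) ^ 2 ∂P) := fun z => by
    obtain ⟨hmem, heq⟩ := eLpNorm_sub_regressionFunction_sq hreg
      (ridgeEstimator k lam (fun j => ((z j).1, ((z j).2 : ℝ))))
    refine (pow_le_pow_left' (hnorm _ hmem) 2).trans (le_of_eq ?_)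
    rw [mul_pow, heq, ridgeEstimator_sub k hlam hn, ← ENNReal.ofReal_pow hc,
      ← ENNReal.ofReal_mul (sq_nonneg c)]
  refine (lintegral_mono hbound).trans ?_
  have hint := integrable_sq_error (n := n) P k.feature.continuous continuous_fst hεc
    (mul_pos hn' hlam) h
  rw [← ofReal_integral_eq_lintegral_ofReal (hint.const_mul _) (.of_forall fun z =>
    mul_nonneg (sq_nonneg c) (integral_nonneg fun _ => sq_nonneg _)), integral_const_mul]
  refine ENNReal.ofReal_le_ofReal (mul_le_mul_of_nonneg_left (hmain.trans ?_) (sq_nonneg c))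
  gcongr

end Rate

end KernelRidge

end

theorem mainTheorem4
    {d : ℕ} (X : Set (EuclideanSpace ℝ (Fin d))) [CompactSpace X]
    (Y : Set ℝ) [CompactSpace Y]
    -- the meta-distribution on the space of probability measures on `X × Y`
    (E : Measure (ProbabilityMeasure (X × Y))) [IsProbabilityMeasure E]
    -- the family of kernels and its uniform bound
    (K : Set (KernelRidge.ContKernel X)) (κ : ℝ) (hκ : 0 < κ)
    (hK : ∀ k ∈ K, ∀ x : X, |k.toMap (x, x)| ≤ κ ^ 2)
    -- regularity of the regression functions, with the kernel `k P` for the domain `P`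
    (k : ProbabilityMeasure (X × Y) → KernelRidge.ContKernel X)
    (hk : ∀ P ∈ E.support, k P ∈ K)
    (c₁ : ℝ) (hc₁ : 0 < c₁)
    (hreg : ∀ P ∈ E.support, KernelRidge.SourceCondition (k P) (P : Measure (X × Y)) c₁)
    -- effective dimensions
    (c₂ c₃ : ℝ) (hc₂ : 0 < c₂) (hc₃ : 0 < c₃) (hc₃' : c₃ ≤ 1)
    (hdim : ∀ P ∈ E.support, ∀ lam : ℝ, 0 < lam → ∀ k' ∈ K,
      KernelRidge.effectiveDimension (k'.integralOp (P : Measure (X × Y)).fst) lam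
        ≤ ENNReal.ofReal (c₂ * lam ^ (-c₃)))
    -- `‖f‖_{L²(X)} ≤ c* ‖f‖_{L²(P)}`
    (cstar : ℝ) (hcstar : 0 < cstar)
    (hnorm : ∀ P ∈ E.support, ∀ f : X → ℝ, MemLp f 2 (P : Measure (X × Y)).fst →
      eLpNorm f 2 (KernelRidge.lebesgueOn X)
        ≤ ENNReal.ofReal cstar * eLpNorm f 2 (P : Measure (X × Y)).fst) :
    0 < KernelRidge.ridgeConstant κ (⨆ y : Y, |(y : ℝ)|) c₁ c₂ ∧
    ∀ P ∈ E.support, ∀ n : ℕ, 0 < n →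
      ∫⁻ z : Fin n → X × Y,
          eLpNorm
            (fun x : X =>
              KernelRidge.ridgeEstimator (k P) ((n : ℝ) ^ (-(1 / (c₃ + 1))))
                  (fun j => ((z j).1, ((z j).2 : ℝ))) x
                - KernelRidge.regressionFunction (P : Measure (X × Y)) x)
            2 (KernelRidge.lebesgueOn X) ^ 2
          ∂(Measure.pi fun _ : Fin n => (P : Measure (X × Y)))
        ≤ ENNReal.ofReal
            (cstar ^ 2 * KernelRidge.ridgeConstant κ (⨆ y : Y, |(y : ℝ)|) c₁ c₂
              * (n : ℝ) ^ (-(1 / (c₃ + 1)))) := by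
  have hM0 : 0 ≤ ⨆ y : Y, |(y : ℝ)| := Real.iSup_nonneg fun y => abs_nonneg _
  have hM : ∀ y : Y, |(y : ℝ)| ≤ ⨆ y : Y, |(y : ℝ)| :=
    le_ciSup (isCompact_range (f := fun y : Y => |(y : ℝ)|) (by fun_prop)).bddAbove
  set M := ⨆ y : Y, |(y : ℝ)|
  refine ⟨KernelRidge.ridgeConstant_pos hκ hM0 hc₁, fun P hP n hn => ?_⟩
  have hn' : (0 : ℝ) < n := by exact_mod_cast hn
  have hnl := KernelRidge.one_le_mul_rpow hn hc₃
  have hrate := KernelRidge.rpow_rpow_div hn hc₃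
  have hlam : 0 < (n : ℝ) ^ (-(1 / (c₃ + 1))) := Real.rpow_pos_of_pos hn' _
  set lam := (n : ℝ) ^ (-(1 / (c₃ + 1)))
  refine (KernelRidge.lintegral_eLpNorm_ridgeEstimator_sub_le hκ (hK _ (hk P hP)) hM
    (hreg P hP) hlam (N := c₂ * lam ^ (-c₃)) (by positivity) (hdim P hP lam hlam _ (hk P hP)) hn
    hcstar.le (hnorm P hP)).trans (ENNReal.ofReal_le_ofReal ?_)
  -- Since `nλ ≥ 1`, the correction factors are bounded uniformly in `n`.
  have hq : κ ^ 2 / (n * lam) ≤ κ ^ 2 := div_le_self (sq_nonneg κ) hnl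
  rw [mul_assoc (cstar ^ 2)]
  refine mul_le_mul_of_nonneg_left ?_ (sq_nonneg _)
  calc 2 * (M + κ * c₁) ^ 2 * (1 + κ ^ 2 / (n * lam)) / n * (c₂ * lam ^ (-c₃)) +
        (1 + κ ^ 2 / (n * lam)) ^ 2 * lam * c₁ ^ 2
      = 2 * (M + κ * c₁) ^ 2 * (1 + κ ^ 2 / (n * lam)) * c₂ * (lam ^ (-c₃) / n) +
        (1 + κ ^ 2 / (n * lam)) ^ 2 * c₁ ^ 2 * lam := by ring
    _ ≤ 2 * (M + κ * c₁) ^ 2 * (1 + κ ^ 2) * c₂ * (lam ^ (-c₃) / n) +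
        (1 + κ ^ 2) ^ 2 * c₁ ^ 2 * lam := by gcongr
    _ = (2 * (M + κ * c₁) ^ 2 * (1 + κ ^ 2) * c₂ + (1 + κ ^ 2) ^ 2 * c₁ ^ 2) * lam := by
        rw [hrate]; ring
    _ ≤ KernelRidge.ridgeConstant κ M c₁ c₂ * lam :=
        mul_le_mul_of_nonneg_right (KernelRidge.le_ridgeConstant hκ hM0 hc₁ hc₂) hlam.le
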